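/- Let $G$ be a finite simple graph. For a family $\mathcal F$ of subsets of the plane $\mathbb R^2$, an intersection representation of $G$ by members of $\mathcal F$ is an indexed collection $(A_v)_{v\in V(G)}$ of (not necessarily different) members of $\mathcal F$ such that, for all distinct $u,v\in V(G)$, $A_u\cap A_v\ne\emptyset$ if and only if $uv\in E(G)$. Then the following are equivalent; that is, the following families of subsets of $\mathbb R^2$ define the same class of (finite) intersection graphs, the string graphs. $G$ has an intersection representation by 1. curves (continuous images of $[0,1]$), i.e. $G$ is a string graph; 2. simple curves (homeomorphic images of $[0,1]$); 3. simple closed curves (homeomorphic images of $S^1$); 4. piecewise-linear simple closed curves; 5. nonempty pathwise-connected sets (any two points are joined by a curve in the set); 6. nonempty arcwise-connected sets (any two distinct points are joined by a simple curve in the set); 7. nonempty open connected sets; 8. nonempty open simply connected sets. Furthermore, if $G$ is a string graph, then for each of the families 1–4 it has an intersection representation $(A_v)$ by members of that family such that: $A_u\cap A_v$ is finite for all $u\neq v$; $A_u\cap A_v\cap A_w=\emptyset$ for all pairwise distinct $u,v,w$; and any two of the curves $A_u,A_v$ ($u\ne v$) cross properly at each of their common points $p$, meaning that there is a homeomorphism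 $h$ from an open neighbourhood $U$ of $p$ onto an open subset of $\mathbb R^2$ with $h(p)=0$ under which $A_u\cap U$ and $A_v\cap U$ become the coordinate axes, i.e. $h(A_u\cap U)=h(U)\cap\{(x,y):y=0\}$ and $h(A_v\cap U)=h(U)\cap\{(x,y):x=0\}$. -/

import Mathlib

namespace StringGraphs

/-- The Euclidean plane. -/
abbrev Plane : Type := EuclideanSpace ℝ (Fin 2)

/-! ### Families of planar sets -/

/-- A planar curve: the image of a continuous map from the unit interval. -/
def IsCurve (A : Set Plane) : Prop :=
  ∃ f : unitInterval → Plane, Continuous f ∧ Set.range f = A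

/-- A simple curve: a homeomorphic image of the unit interval. -/
def IsSimpleCurve (A : Set Plane) : Prop :=
  ∃ f : unitInterval → Plane, Topology.IsEmbedding f ∧ Set.range f = A

/-- A simple closed curve: a homeomorphic image of the unit circle. -/
def IsSimpleClosedCurve (A : Set Plane) : Prop :=
  ∃ f : Circle → Plane, Topology.IsEmbedding f ∧ Set.range f = A

/-- `f` is piecewise linear on `[0, 1]`: for some subdivision `0 = t 0 < t 1 < ⋯ < t n = 1`, on
each `[t i, t (i + 1)]` it interpolates linearly between its values at the two ends.
(In particular `f` is continuous on `[0, 1]`.) -/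
def IsPiecewiseLinearOnUnit (f : ℝ → Plane) : Prop :=
  ∃ (n : ℕ) (t : ℕ → ℝ), t 0 = 0 ∧ t n = 1 ∧
    ∀ i < n, t i < t (i + 1) ∧ ∀ c ∈ Set.Icc (0 : ℝ) 1,
      f (AffineMap.lineMap (t i) (t (i + 1)) c) =
        AffineMap.lineMap (f (t i)) (f (t (i + 1))) c

/-- A piecewise-linear simple closed curve: the image of a closed piecewise-linear
parametrization that is injective apart from the coincidence of its two ends. -/
def IsPLSimpleClosedCurve (A : Set Plane) : Prop :=
  ∃ f : ℝ → Plane, IsPiecewiseLinearOnUnit f ∧ f 0 = f 1 ∧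
    Set.InjOn f (Set.Ico 0 1) ∧ f '' Set.Icc 0 1 = A

/-- An arcwise-connected set: it is nonempty and any two distinct points of it are the endpoints
of a simple curve contained in it. (Pathwise-connected sets are Mathlib's `IsPathConnected`.) -/
def IsArcwiseConnected (A : Set Plane) : Prop :=
  A.Nonempty ∧ ∀ x ∈ A, ∀ y ∈ A, x ≠ y →
    ∃ f : unitInterval → Plane, Topology.IsEmbedding f ∧ f 0 = x ∧ f 1 = y ∧ Set.range f ⊆ A

/-- An open connected set. -/
def IsOpenConnected (A : Set Plane) : Prop := IsOpen A ∧ IsConnected A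

/-- An open simply connected set. -/
def IsOpenSimplyConnected (A : Set Plane) : Prop := IsOpen A ∧ IsSimplyConnected A

/-! ### Intersection graphs -/

/-- The sets `A v` form an intersection representation of `G`: distinct vertices are adjacent
exactly when their sets meet. -/
def IsIntersectionRep {V : Type*} (G : SimpleGraph V) (A : V → Set Plane) : Prop :=
  ∀ u v : V, u ≠ v → (G.Adj u v ↔ (A u ∩ A v).Nonempty)

/-- `G` is an intersection graph of members of the family `F` of planar sets. -/
def IsIntersectionGraph (F : Set Plane → Prop) {V : Type*} (G : SimpleGraph V) : Prop :=
  ∃ A : V → Set Plane, (∀ v, F (A v)) ∧ IsIntersectionRep G A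

/-- A string graph: an intersection graph of planar curves. -/
def IsStringGraph {V : Type*} (G : SimpleGraph V) : Prop := IsIntersectionGraph IsCurve G

/-! ### Proper crossings -/

/-- `A` and `B` cross properly at `p`: in suitable local coordinates of the plane, centred at `p`,
they are the two coordinate axes. -/
def CrossProperlyAt (A B : Set Plane) (p : Plane) : Prop :=
  ∃ h : OpenPartialHomeomorph Plane Plane, p ∈ h.source ∧ h p = 0 ∧
    ∀ q ∈ h.source, (q ∈ A ↔ h q 1 = 0) ∧ (q ∈ B ↔ h q 0 = 0)

/-- Any two sets of the collection meet in finitely many points, no three of them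
have a common point, and any two of them cross properly at each of their common points. -/
structure IsInGeneralPosition {V : Type*} (A : V → Set Plane) : Prop where
  finite_inter : ∀ u v, u ≠ v → (A u ∩ A v).Finite
  no_triple : ∀ u v w, u ≠ v → u ≠ w → v ≠ w → A u ∩ A v ∩ A w = ∅
  proper : ∀ u v, u ≠ v → ∀ p ∈ A u ∩ A v, CrossProperlyAt (A u) (A v) p

/-- `G` has an intersection representation in general position by members of `F`. -/
def HasGeneralPositionRep (F : Set Plane → Prop) {V : Type*} (G : SimpleGraph V) : Prop :=
  ∃ A : V → Set Plane, (∀ v, F (A v)) ∧ IsIntersectionRep G A ∧ IsInGeneralPosition A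

end StringGraphs

namespace StringGraphs

open Set AffineMap Filter Topology
open scoped Pointwise

/-! All families are compared through open connected sets. Each curve, simple closed curve or
arcwise-connected set is path-connected. From path-connected sets, keep in each only finitely many
paths joining a base point to chosen meeting points. The resulting compact connected sets have the
same intersection pattern, and a small thickening makes them open without new intersections
(`isIntersectionGraph_isOpenConnected`).

Conversely, an open connected set contains a polygon with finitely many prescribed points on it,
inside it or outside it (`exists_isPLLoop_sign`): piecewise linear homeomorphisms supported in the
set move finitely many points at will, so a small taxicab circle can be carried to such a polygon.
Hence for adjacent vertices one loop can be made to visit both sides of the other, and the insides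
of the two can be made to share a point (`exists_stable_loops`). The insides form an open simply
connected representation.

Visiting both sides survives small translations, while generic translations put polygons in general
position: each bad incidence is an affine condition on the translations with nowhere dense solution
set, and there are countably many conditions (`eventually_residual_isInGeneralPosition`). Baire's
theorem provides a translation that is both small and generic. Cutting each loop open near its
initial vertex, which is on no other loop, yields simple curves with the same crossings. -/

/-! ### Piecewise linear maps of an interval -/

/-- `f` interpolates linearly between its values at `a` and `b`. -/
def AffOn {E : Type*} [AddCommGroup E] [Module ℝ E] (f : ℝ → E) (a b : ℝ) : Prop :=
  ∀ c ∈ Icc (0 : ℝ) 1, f (lineMap a b c) = lineMap (f a) (f b) c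

/-- `f` is piecewise linear on `[a, b]`. -/
inductive PLOn {E : Type*} [AddCommGroup E] [Module ℝ E] (f : ℝ → E) : ℝ → ℝ → Prop
  | single (a b : ℝ) : a < b → AffOn f a b → PLOn f a b
  | snoc (a b c : ℝ) : PLOn f a b → b < c → AffOn f b c → PLOn f a c

/-- `φ` is affine on each of the two half spaces bounded by the zero set of the affine
function `l`. -/
structure IsFold {E E' : Type*} [AddCommGroup E] [Module ℝ E] [AddCommGroup E'] [Module ℝ E']
    (φ : E → E') (l : E → ℝ) : Prop where
  affine : ∀ x y, ∀ c ∈ Icc (0 : ℝ) 1, l (lineMap x y c) = lineMap (l x) (l y) c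
  nonneg : ∀ x y, 0 ≤ l x → 0 ≤ l y → ∀ c ∈ Icc (0 : ℝ) 1,
    φ (lineMap x y c) = lineMap (φ x) (φ y) c
  nonpos : ∀ x y, l x ≤ 0 → l y ≤ 0 → ∀ c ∈ Icc (0 : ℝ) 1,
    φ (lineMap x y c) = lineMap (φ x) (φ y) c

section PL

variable {E E' : Type*} [AddCommGroup E] [Module ℝ E] [AddCommGroup E'] [Module ℝ E']

theorem lineMap_lineMap_lineMap {E : Type*} [AddCommGroup E] [Module ℝ E] (x y : E) (s t c : ℝ) :
    lineMap (lineMap x y s) (lineMap x y t) c = (lineMap x y (lineMap s t c) : E) := by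
  simp only [lineMap_apply_module]
  module

theorem lineMap_mem_Icc {s t c : ℝ} (hs : s ∈ Icc (0 : ℝ) 1) (ht : t ∈ Icc (0 : ℝ) 1)
    (hc : c ∈ Icc (0 : ℝ) 1) : lineMap s t c ∈ Icc (0 : ℝ) 1 :=
  (convex_Icc (0 : ℝ) 1).lineMap_mem hs ht hc

theorem AffOn.sub {f : ℝ → E} {a b s t : ℝ} (h : AffOn f a b) (hs : s ∈ Icc (0 : ℝ) 1)
    (ht : t ∈ Icc (0 : ℝ) 1) : AffOn f (lineMap a b s) (lineMap a b t) := by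
  intro c hc
  rw [lineMap_lineMap_lineMap, h _ (lineMap_mem_Icc hs ht hc), h _ hs, h _ ht,
    lineMap_lineMap_lineMap]

theorem PLOn.trans {f : ℝ → E} {a b c : ℝ} (h₁ : PLOn f a b) (h₂ : PLOn f b c) :
    PLOn f a c := by
  induction h₂ with
  | single c hbc h => exact .snoc _ _ _ h₁ hbc h
  | snoc c d _ hcd h ih => exact .snoc _ _ _ ih hcd h

/-- If `l` changes sign strictly along the segment, cut it at the zero of `l`; each half stays in a
closed half space, where `φ` is affine. -/
theorem AffOn.comp_fold {f : ℝ → E} {φ : E → E'} {l : E → ℝ} (hφ : IsFold φ l) {a b : ℝ}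
    (hab : a < b) (h : AffOn f a b) : PLOn (fun t => φ (f t)) a b := by
  have pos : ∀ a b : ℝ, AffOn f a b → 0 ≤ l (f a) → 0 ≤ l (f b) →
      AffOn (fun t => φ (f t)) a b := fun a b h ha hb c hc => by
    simp only [h c hc, hφ.nonneg _ _ ha hb c hc]
  have neg : ∀ a b : ℝ, AffOn f a b → l (f a) ≤ 0 → l (f b) ≤ 0 →
      AffOn (fun t => φ (f t)) a b := fun a b h ha hb c hc => by
    simp only [h c hc, hφ.nonpos _ _ ha hb c hc]
  have cut : l (f a) * l (f b) < 0 → ∃ z, a < z ∧ z < b ∧ l (f z) = 0 ∧ AffOn f a z ∧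
      AffOn f z b := by
    intro hlt
    have hne : l (f a) - l (f b) ≠ 0 := fun h0 => by
      rw [sub_eq_zero.1 h0] at hlt; nlinarith [mul_self_nonneg (l (f b))]
    -- The root of the affine function `c ↦ (1 - c) * l (f a) + c * l (f b)`.
    set s := l (f a) / (l (f a) - l (f b)) with hs
    have hs01 : 0 < s ∧ s < 1 := by
      rcases lt_or_gt_of_ne hne with h1 | h1
      · have : l (f a) < 0 := by by_contra! h2; nlinarith
        exact ⟨div_pos_of_neg_of_neg this h1, (div_lt_one_of_neg h1).2 (by nlinarith)⟩
      · have : 0 < l (f a) := by by_contra! h2; nlinarith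
        exact ⟨div_pos this h1, (div_lt_one h1).2 (by nlinarith)⟩
    have hsI : s ∈ Icc (0 : ℝ) 1 := ⟨hs01.1.le, hs01.2.le⟩
    refine ⟨lineMap a b s, ?_, ?_, ?_, ?_, ?_⟩
    · rw [lineMap_apply_module]; simp only [smul_eq_mul]; nlinarith
    · rw [lineMap_apply_module]; simp only [smul_eq_mul]; nlinarith
    · rw [h s hsI, hφ.affine _ _ _ hsI, lineMap_apply_module]
      simp only [smul_eq_mul, hs]; field_simp; ring
    · simpa using h.sub (left_mem_Icc.2 zero_le_one) hsI
    · simpa using h.sub hsI (right_mem_Icc.2 zero_le_one)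
  rcases le_total 0 (l (f a)) with ha | ha <;> rcases le_total 0 (l (f b)) with hb | hb
  · exact .single _ _ hab (pos _ _ h ha hb)
  -- Pieces must have positive length, so a zero at an end is treated without cutting.
  · rcases ha.eq_or_lt with ha' | ha'
    · exact .single _ _ hab (neg _ _ h ha'.symm.le hb)
    rcases hb.eq_or_lt with hb' | hb'
    · exact .single _ _ hab (pos _ _ h ha hb'.symm.le)
    obtain ⟨z, h1, h2, h0, h3, h4⟩ := cut (mul_neg_of_pos_of_neg ha' hb')
    exact .snoc _ _ _ (.single _ _ h1 (pos _ _ h3 ha h0.symm.le)) h2 (neg _ _ h4 h0.le hb)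
  · rcases ha.eq_or_lt with ha' | ha'
    · exact .single _ _ hab (pos _ _ h ha'.symm.le hb)
    rcases hb.eq_or_lt with hb' | hb'
    · exact .single _ _ hab (neg _ _ h ha hb'.symm.le)
    obtain ⟨z, h1, h2, h0, h3, h4⟩ := cut (mul_neg_of_neg_of_pos ha' hb')
    exact .snoc _ _ _ (.single _ _ h1 (neg _ _ h3 ha h0.le)) h2 (pos _ _ h4 h0.symm.le hb)
  · exact .single _ _ hab (neg _ _ h ha hb)

theorem PLOn.comp_fold {f : ℝ → E} {φ : E → E'} {l : E → ℝ} (hφ : IsFold φ l) {a b : ℝ}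
    (h : PLOn f a b) : PLOn (fun t => φ (f t)) a b := by
  induction h with
  | single b hab h => exact h.comp_fold hφ hab
  | snoc b c _ hbc h ih => exact ih.trans (h.comp_fold hφ hbc)

end PL

theorem PLOn.isPiecewiseLinearOnUnit {f : ℝ → Plane} (h : PLOn f 0 1) :
    IsPiecewiseLinearOnUnit f := by
  have key : ∀ a b, PLOn f a b → ∃ (n : ℕ) (t : ℕ → ℝ), t 0 = a ∧ t n = b ∧
      ∀ i < n, t i < t (i + 1) ∧ AffOn f (t i) (t (i + 1)) := by
    intro a b h
    induction h with
    | single b hab h =>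
      refine ⟨1, fun i => if i = 0 then a else b, by simp, by simp, fun i hi => ?_⟩
      obtain rfl : i = 0 := by omega
      simpa using ⟨hab, h⟩
    | snoc b c _ hbc h ih =>
      obtain ⟨n, t, h0, hn, ht⟩ := ih
      refine ⟨n + 1, fun i => if i ≤ n then t i else c, by simpa using h0, by simp,
        fun i hi => ?_⟩
      rcases (Nat.lt_succ_iff.1 hi).eq_or_lt with rfl | hi'
      · simpa [hn] using ⟨hbc, h⟩
      · simpa [hi'.le, Nat.succ_le_of_lt hi'] using ht i hi'
  exact key 0 1 h

theorem IsPiecewiseLinearOnUnit.plOn {f : ℝ → Plane} (h : IsPiecewiseLinearOnUnit f) :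
    PLOn f 0 1 := by
  obtain ⟨n, t, h0, hn, ht⟩ := h
  have key : ∀ i < n, PLOn f (t 0) (t (i + 1)) := by
    intro i
    induction i with
    | zero => exact fun hi => .single _ _ (ht 0 hi).1 (ht 0 hi).2
    | succ i ih => exact fun hi => .snoc _ _ _ (ih (by omega)) (ht _ hi).1 (ht _ hi).2
  cases n with
  | zero => rw [h0] at hn; exact absurd hn zero_ne_one
  | succ n => simpa [h0, hn] using key n n.lt_succ_self

theorem AffOn.eq_on {E : Type*} [AddCommGroup E] [Module ℝ E] {f : ℝ → E} {a b : ℝ}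
    (hab : a < b) (h : AffOn f a b) {x : ℝ} (hx : x ∈ Icc a b) :
    f x = lineMap (f a) (f b) ((x - a) / (b - a)) := by
  have hba : 0 < b - a := sub_pos.2 hab
  have h1 := h ((x - a) / (b - a)) ⟨div_nonneg (by linarith [hx.1]) hba.le,
    (div_le_one hba).2 (by linarith [hx.2])⟩
  rw [← h1]
  congr 1
  rw [lineMap_apply_module]; simp only [smul_eq_mul]; field_simp; ring

theorem PLOn.continuousOn {f : ℝ → Plane} {a b : ℝ} (h : PLOn f a b) :
    a < b ∧ ContinuousOn f (Icc a b) := by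
  have aff : ∀ a b, a < b → AffOn f a b → ContinuousOn f (Icc a b) := fun a b hab h => by
    refine ContinuousOn.congr (f := fun x => lineMap (f a) (f b) ((x - a) / (b - a))) ?_
      fun x hx => h.eq_on hab hx
    simp only [lineMap_apply_module]
    fun_prop
  induction h with
  | single b hab h => exact ⟨hab, aff a b hab h⟩
  | snoc b c _ hbc h ih =>
    refine ⟨ih.1.trans hbc, ?_⟩
    rw [← Icc_union_Icc_eq_Icc ih.1.le hbc.le]
    exact ih.2.union_of_isClosed (aff b c hbc h) isClosed_Icc isClosed_Icc

/-- A piecewise linear parametrization of a simple closed curve. -/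
structure IsPLLoop (f : ℝ → Plane) : Prop where
  pl : IsPiecewiseLinearOnUnit f
  closed : f 0 = f 1
  injOn : InjOn f (Ico 0 1)

theorem IsPLLoop.continuousOn {f : ℝ → Plane} (h : IsPLLoop f) : ContinuousOn f (Icc 0 1) :=
  h.pl.plOn.continuousOn.2

theorem IsPLLoop.isPLSimpleClosedCurve {f : ℝ → Plane} (h : IsPLLoop f) :
    IsPLSimpleClosedCurve (f '' Icc 0 1) := ⟨f, h.pl, h.closed, h.injOn, rfl⟩

theorem isPLSimpleClosedCurve_iff {A : Set Plane} :
    IsPLSimpleClosedCurve A ↔ ∃ f, IsPLLoop f ∧ f '' Icc 0 1 = A :=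
  ⟨fun ⟨f, h1, h2, h3, h4⟩ => ⟨f, ⟨h1, h2, h3⟩, h4⟩,
    fun ⟨_, h, h4⟩ => h4 ▸ h.isPLSimpleClosedCurve⟩

/-- The parametrization descends to `ℝ / ℤ`; a continuous injection of a compact space into a
Hausdorff space is an embedding. -/
theorem IsPLSimpleClosedCurve.isSimpleClosedCurve {A : Set Plane}
    (h : IsPLSimpleClosedCurve A) : IsSimpleClosedCurve A := by
  obtain ⟨f, hf, rfl⟩ := isPLSimpleClosedCurve_iff.1 h
  have : Fact ((0 : ℝ) < 1) := ⟨one_pos⟩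
  have hc : Continuous (AddCircle.liftIco 1 0 f) :=
    AddCircle.liftIco_zero_continuous hf.closed hf.continuousOn
  have hrep : ∀ x : AddCircle (1 : ℝ), ∃ s ∈ Ico (0 : ℝ) 1, (s : AddCircle (1 : ℝ)) = x := fun x => by
    obtain ⟨s, hs, rfl⟩ := AddCircle.coe_image_Ico_eq (1 : ℝ) 0 ▸ mem_univ x
    exact ⟨s, by simpa using hs, rfl⟩
  have hinj : Function.Injective (AddCircle.liftIco 1 0 f) := by
    intro x y hxy
    obtain ⟨s, hs, rfl⟩ := hrep x
    obtain ⟨t, ht, rfl⟩ := hrep y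
    rw [AddCircle.liftIco_zero_coe_apply hs, AddCircle.liftIco_zero_coe_apply ht] at hxy
    rw [hf.injOn hs ht hxy]
  refine ⟨_, (hc.isClosedEmbedding hinj).isEmbedding.comp
    (AddCircle.homeomorphCircle one_ne_zero).symm.isEmbedding, ?_⟩
  rw [Function.comp_def, ← Function.comp_def,
    (AddCircle.homeomorphCircle one_ne_zero).symm.surjective.range_comp]
  ext p
  constructor
  · rintro ⟨x, rfl⟩
    obtain ⟨s, hs, rfl⟩ := hrep x
    exact ⟨s, Ico_subset_Icc_self hs, (AddCircle.liftIco_zero_coe_apply hs).symm⟩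
  · rintro ⟨s, hs, rfl⟩
    rcases hs.2.eq_or_lt with rfl | h1
    · exact ⟨((0 : ℝ) : AddCircle (1 : ℝ)), by
        rw [AddCircle.liftIco_zero_coe_apply (by simp), hf.closed]⟩
    · exact ⟨s, AddCircle.liftIco_zero_coe_apply ⟨hs.1, h1⟩⟩

/-! ### Piecewise linear homeomorphisms with small support -/

/-- The taxicab distance of the plane. -/
noncomputable def taxi (c x : Plane) : ℝ := |x 0 - c 0| + |x 1 - c 1|

theorem norm_sub_le_taxi (c x : Plane) : ‖x - c‖ ≤ taxi c x := by
  rw [EuclideanSpace.norm_eq, Real.sqrt_le_iff, Fin.sum_univ_two, taxi]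
  simp only [PiLp.sub_apply, Real.norm_eq_abs]
  exact ⟨by positivity, by nlinarith [abs_nonneg (x 0 - c 0), abs_nonneg (x 1 - c 1)]⟩

theorem abs_coord_le_norm (x : Plane) (i : Fin 2) : |x i| ≤ ‖x‖ := PiLp.norm_apply_le x i

theorem abs_taxi_sub_taxi_le (c x y : Plane) : |taxi c x - taxi c y| ≤ 2 * ‖x - y‖ := by
  have h0 := abs_coord_le_norm (x - y) 0
  have h1 := abs_coord_le_norm (x - y) 1
  simp only [PiLp.sub_apply] at h0 h1
  have e0 := abs_abs_sub_abs_le (x 0 - c 0) (y 0 - c 0)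
  have e1 := abs_abs_sub_abs_le (x 1 - c 1) (y 1 - c 1)
  rw [sub_sub_sub_cancel_right] at e0 e1
  unfold taxi
  rw [abs_le] at e0 e1 ⊢
  constructor <;> linarith

theorem continuous_taxi (c : Plane) : Continuous (taxi c) := by
  unfold taxi
  fun_prop

/-- Push the points near `c` by `w`, the push decreasing linearly to `0` at taxicab
distance `r`. -/
noncomputable def pushMap (c : Plane) (r : ℝ) (w x : Plane) : Plane :=
  x + max 0 (1 - taxi c x / r) • w

theorem approximatesLinearOn_pushMap (c : Plane) {r : ℝ} (hr : 0 < r) (w : Plane) :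
    ApproximatesLinearOn (pushMap c r w) ((ContinuousLinearEquiv.refl ℝ Plane : Plane →L[ℝ] Plane))
      univ (2 * ‖w‖₊ / r.toNNReal) := by
  intro x _ y _
  have h : pushMap c r w x - pushMap c r w y - (x - y) =
      (max 0 (1 - taxi c x / r) - max 0 (1 - taxi c y / r)) • w := by
    unfold pushMap; module
  have h2 : |max 0 (1 - taxi c x / r) - max 0 (1 - taxi c y / r)| ≤ 2 * ‖x - y‖ / r := by
    rw [max_comm 0, max_comm 0]
    refine (abs_max_sub_max_le_abs _ _ _).trans ?_ |>.trans
      (div_le_div_of_nonneg_right (abs_taxi_sub_taxi_le c x y) hr.le)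
    rw [sub_sub_sub_cancel_left, ← sub_div, abs_div, abs_of_pos hr, abs_sub_comm]
  simp only [ContinuousLinearEquiv.coe_coe, ContinuousLinearEquiv.coe_refl', id_eq, h, norm_smul,
    Real.norm_eq_abs]
  calc _ ≤ 2 * ‖x - y‖ / r * ‖w‖ := by gcongr
    _ = _ := by simp [Real.coe_toNNReal r hr.le]; ring

/-- The push differs from the identity by a map with Lipschitz constant `2 * ‖w‖ / r < 1`. -/
theorem exists_homeomorph_pushMap (c : Plane) {r : ℝ} (hr : 0 < r) {w : Plane}
    (hw : ‖w‖ < r / 2) : ∃ H : Plane ≃ₜ Plane, ⇑H = pushMap c r w := by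
  refine ⟨(approximatesLinearOn_pushMap c hr w).toHomeomorph _ (.inr ?_), rfl⟩
  have : ‖((ContinuousLinearEquiv.refl ℝ Plane).symm : Plane →L[ℝ] Plane)‖₊ = 1 := by
    ext; simp
  rw [this, inv_one, ← NNReal.coe_lt_coe]
  push_cast
  rw [Real.coe_toNNReal r hr.le, div_lt_one hr]
  linarith

/-- The push is a composition of three folds through `Plane × ℝ`: the extra coordinate accumulates
the taxicab distance one absolute value at a time, and the last fold is the cutoff by `max`. This is
why the taxicab distance is used. -/
theorem PLOn.pushMap {f : ℝ → Plane} {a b : ℝ} (h : PLOn f a b) (c : Plane)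
    (r : ℝ) (w : Plane) : PLOn (fun t => pushMap c r w (f t)) a b := by
  have h1 : IsFold (fun x : Plane => (x, |x 0 - c 0|)) (fun x => x 0 - c 0) := by
    refine ⟨fun x y s hs => ?_, fun x y hx hy s hs => ?_, fun x y hx hy s hs => ?_⟩
    · simp [lineMap_apply_module]; ring
    · have : 0 ≤ (1 - s) * (x 0 - c 0) + s * (y 0 - c 0) :=
        add_nonneg (mul_nonneg (by linarith [hs.2]) hx) (mul_nonneg hs.1 hy)
      rw [abs_of_nonneg hx, abs_of_nonneg hy, abs_of_nonneg]
      · ext <;> simp [lineMap_apply_module]; ring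
      · simp [lineMap_apply_module]; linarith
    · have : 0 ≤ (1 - s) * (c 0 - x 0) + s * (c 0 - y 0) :=
        add_nonneg (mul_nonneg (by linarith [hs.2]) (by linarith))
          (mul_nonneg hs.1 (by linarith))
      rw [abs_of_nonpos hx, abs_of_nonpos hy, abs_of_nonpos]
      · ext <;> simp [lineMap_apply_module]; ring
      · simp [lineMap_apply_module]; linarith
  have h2 : IsFold (fun x : Plane × ℝ => (x.1, x.2 + |x.1 1 - c 1|))
      (fun x => x.1 1 - c 1) := by
    refine ⟨fun x y s hs => ?_, fun x y hx hy s hs => ?_, fun x y hx hy s hs => ?_⟩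
    · simp [lineMap_apply_module]; ring
    · have : 0 ≤ (1 - s) * (x.1 1 - c 1) + s * (y.1 1 - c 1) :=
        add_nonneg (mul_nonneg (by linarith [hs.2]) hx) (mul_nonneg hs.1 hy)
      rw [abs_of_nonneg hx, abs_of_nonneg hy, abs_of_nonneg]
      · ext <;> simp [lineMap_apply_module]; ring
      · simp [lineMap_apply_module]; linarith
    · have : 0 ≤ (1 - s) * (c 1 - x.1 1) + s * (c 1 - y.1 1) :=
        add_nonneg (mul_nonneg (by linarith [hs.2]) (by linarith))
          (mul_nonneg hs.1 (by linarith))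
      rw [abs_of_nonpos hx, abs_of_nonpos hy, abs_of_nonpos]
      · ext <;> simp [lineMap_apply_module]; ring
      · simp [lineMap_apply_module]; linarith
  have h3 : IsFold (fun x : Plane × ℝ => x.1 + max 0 (1 - x.2 / r) • w)
      (fun x => 1 - x.2 / r) := by
    have e : ∀ (x y : Plane × ℝ) (s : ℝ), 1 - (lineMap x y s).2 / r =
        (1 - s) * (1 - x.2 / r) + s * (1 - y.2 / r) := fun x y s => by
      simp [lineMap_apply_module]; ring
    refine ⟨fun x y s hs => ?_, fun x y hx hy s hs => ?_, fun x y hx hy s hs => ?_⟩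
    · rw [e]; simp [lineMap_apply_module]
    · have : 0 ≤ (1 - s) * (1 - x.2 / r) + s * (1 - y.2 / r) :=
        add_nonneg (mul_nonneg (by linarith [hs.2]) hx) (mul_nonneg hs.1 hy)
      rw [e, max_eq_right hx, max_eq_right hy, max_eq_right this]
      simp only [lineMap_apply_module, Prod.fst_add, Prod.smul_fst]
      module
    · have : 0 ≤ (1 - s) * (-(1 - x.2 / r)) + s * (-(1 - y.2 / r)) :=
        add_nonneg (mul_nonneg (by linarith [hs.2]) (by linarith))
          (mul_nonneg hs.1 (by linarith))
      rw [e, max_eq_left hx, max_eq_left hy, max_eq_left (by linarith)]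
      simp only [lineMap_apply_module, Prod.fst_add, Prod.smul_fst]
      module
  exact ((h.comp_fold h1).comp_fold h2).comp_fold h3

/-- `H` is a homeomorphism of the plane that is the identity outside `U` and preserves
piecewise linear paths. -/
structure IsMove (U : Set Plane) (H : Plane ≃ₜ Plane) : Prop where
  fixed : ∀ x, x ∉ U → H x = x
  pl : ∀ f : ℝ → Plane, PLOn f 0 1 → PLOn (fun t => H (f t)) 0 1

theorem IsMove.refl (U : Set Plane) : IsMove U (Homeomorph.refl Plane) :=
  ⟨fun _ _ => rfl, fun _ h => h⟩

theorem IsMove.trans {U : Set Plane} {H K : Plane ≃ₜ Plane} (hH : IsMove U H) (hK : IsMove U K) :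
    IsMove U (H.trans K) :=
  ⟨fun x hx => by simp [hH.fixed x hx, hK.fixed x hx], fun f h => hK.pl _ (hH.pl f h)⟩

theorem IsMove.mono {U W : Set Plane} (h : W ⊆ U) {H : Plane ≃ₜ Plane} (hH : IsMove W H) :
    IsMove U H :=
  ⟨fun x hx => hH.fixed x fun hxW => hx (h hxW), hH.pl⟩

theorem IsMove.mem {U : Set Plane} {H : Plane ≃ₜ Plane} (hH : IsMove U H) {x : Plane}
    (hx : x ∈ U) : H x ∈ U := by
  by_contra h
  exact h ((H.injective (hH.fixed _ h)).symm ▸ hx)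

theorem IsMove.isPLLoop {U : Set Plane} {H : Plane ≃ₜ Plane} (hH : IsMove U H) {f : ℝ → Plane}
    (hf : IsPLLoop f) : IsPLLoop (fun t => H (f t)) :=
  ⟨(hH.pl _ hf.pl.plOn).isPiecewiseLinearOnUnit, congrArg H hf.closed,
    H.injective.injOn.comp hf.injOn (mapsTo_univ _ _)⟩

theorem exists_isMove_of_near {U : Set Plane} {x y : Plane} {r : ℝ} (hr : 0 < r)
    (hU : Metric.ball x r ⊆ U) (hy : ‖y - x‖ < r / 2) : ∃ H, IsMove U H ∧ H x = y := by
  obtain ⟨H, hH⟩ := exists_homeomorph_pushMap x hr hy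
  refine ⟨H, ⟨fun z hz => ?_, fun f hf => ?_⟩, ?_⟩
  · have h1 : r ≤ ‖z - x‖ := by
      by_contra! h
      exact hz (hU (by rwa [Metric.mem_ball, dist_eq_norm]))
    have h2 : 1 ≤ taxi x z / r := (one_le_div hr).2 (h1.trans (norm_sub_le_taxi x z))
    rw [hH, pushMap, max_eq_left (by linarith), zero_smul, add_zero]
  · rw [hH]; exact hf.pushMap x r _
  · simp [hH, pushMap, taxi]

/-- Being related by a move is transitive and holds, in both directions, between nearby points;
connectedness does the rest. -/
theorem exists_isMove {U : Set Plane} (hU : IsOpen U) (hc : IsPreconnected U) {x y : Plane}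
    (hx : x ∈ U) (hy : y ∈ U) : ∃ H, IsMove U H ∧ H x = y := by
  refine hc.induction₂' (fun x y => ∃ H, IsMove U H ∧ H x = y) ?_ ?_ hx hy
  · intro x hx
    obtain ⟨r, hr, hrU⟩ := Metric.isOpen_iff.1 hU x hx
    refine nhdsWithin_le_nhds ?_
    filter_upwards [Metric.ball_mem_nhds x (show 0 < r / 4 by positivity)] with y hy
    rw [Metric.mem_ball, dist_eq_norm] at hy
    refine ⟨exists_isMove_of_near hr hrU (by linarith),
      -- The move back is centred at `y`, at distance less than `r / 4` from `x`, so its ball needs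
      -- the smaller radius `r / 2`.
      exists_isMove_of_near (r := r / 2) (by positivity) (fun z hz => hrU ?_)
        (by rw [norm_sub_rev]; linarith)⟩
    rw [Metric.mem_ball] at hz ⊢
    have := dist_triangle z y x
    rw [dist_eq_norm y x] at this
    linarith
  · rintro x y z _ _ _ ⟨H, hH, rfl⟩ ⟨K, hK, rfl⟩
    exact ⟨H.trans K, hH.trans hK, rfl⟩

/-! ### Removing countable sets from connected open sets, and moving several points. -/

theorem one_lt_rank_plane : 1 < Module.rank ℝ Plane := by
  rw [← Module.finrank_eq_rank]; simp

/-- The ball is homeomorphic to the plane, where complements of countable sets are path-connected.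
-/
theorem isPathConnected_ball_diff {x : Plane} {r : ℝ} (hr : 0 < r) {F : Set Plane}
    (hF : F.Countable) : IsPathConnected (Metric.ball x r \ F) := by
  set φ := OpenPartialHomeomorph.univBall x r
  have hs : φ.source = univ := OpenPartialHomeomorph.univBall_source x r
  have ht : φ.target = Metric.ball x r := OpenPartialHomeomorph.univBall_target x hr
  have hinj : Function.Injective φ := by
    rw [← injOn_univ, ← hs]; exact φ.injOn
  have hcont : Continuous φ := by
    rw [← continuousOn_univ, ← hs]; exact φ.continuousOn
  have := ((hF.preimage hinj).isPathConnected_compl_of_one_lt_rank one_lt_rank_plane).image hcont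
  convert this using 1
  rw [← ht, ← φ.image_source_eq_target, hs, ← preimage_compl, image_preimage_eq_inter_range,
    image_univ, sdiff_eq, inter_comm]

/-- The induction runs over all of `U`, including points of `F`; hence the relation speaks of nearby
points off `F`. For transitivity, such a point exists near the middle one because the complement of
`F` is dense. -/
theorem isPreconnected_diff {U : Set Plane} (hU : IsOpen U) (hc : IsPreconnected U)
    {F : Set Plane} (hF : F.Countable) : IsPreconnected (U \ F) := by
  have key : ∀ x ∈ U, ∀ y ∈ U, ∀ᶠ x' in 𝓝 x, ∀ᶠ y' in 𝓝 y,
      x' ∉ F → y' ∉ F → JoinedIn (U \ F) x' y' := by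
    intro x hx y hy
    refine hc.induction₂' (fun x y => ∀ᶠ x' in 𝓝 x, ∀ᶠ y' in 𝓝 y,
      x' ∉ F → y' ∉ F → JoinedIn (U \ F) x' y') ?_ ?_ hx hy
    · intro x hx
      obtain ⟨r, hr, hrU⟩ := Metric.isOpen_iff.1 hU x hx
      have hj : ∀ a ∈ Metric.ball x r, ∀ b ∈ Metric.ball x r, a ∉ F → b ∉ F →
          JoinedIn (U \ F) a b := fun a ha b hb haF hbF =>
        ((isPathConnected_ball_diff hr hF).joinedIn a ⟨ha, haF⟩ b ⟨hb, hbF⟩).mono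
          (sdiff_subset_sdiff_left hrU)
      refine nhdsWithin_le_nhds ?_
      filter_upwards [Metric.ball_mem_nhds x hr] with y hy
      have hxb := Metric.ball_mem_nhds x hr
      have hyb := Metric.isOpen_ball.mem_nhds hy
      constructor
      · filter_upwards [hxb] with a ha
        filter_upwards [hyb] with b hb using hj a ha b hb
      · filter_upwards [hyb] with a ha
        filter_upwards [hxb] with b hb using hj a ha b hb
    · intro x y z _ _ _ h1 h2
      filter_upwards [h1] with a ha
      obtain ⟨b, hbF, hb1, hb2⟩ := (hF.dense_compl ℝ).inter_nhds_nonempty (ha.and h2)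
      filter_upwards [hb2] with d hd haF hdF using (hb1 haF hbF).trans (hd hbF hdF)
  refine isPreconnected_of_forall_pair fun x hx y hy => ?_
  obtain ⟨p, hp⟩ := (key x hx.1 y hy.1).self_of_nhds.self_of_nhds hx.2 hy.2
  exact ⟨range p, range_subset_iff.2 hp, ⟨0, p.source⟩, ⟨1, p.target⟩,
    isPreconnected_range p.continuous⟩

/-- Finitely many points of a connected open set can be moved to arbitrary positions in the
set by a piecewise linear homeomorphism. -/
theorem exists_isMove_finite {U : Set Plane} (hU : IsOpen U) (hc : IsPreconnected U)
    {ι : Type*} [Finite ι] {a b : ι → Plane} (ha : Function.Injective a)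
    (hb : Function.Injective b) (haU : ∀ i, a i ∈ U) (hbU : ∀ i, b i ∈ U) :
    ∃ H, IsMove U H ∧ ∀ i, H (a i) = b i := by
  classical
  cases nonempty_fintype ι
  suffices h : ∀ s : Finset ι, ∃ H, IsMove U H ∧ ∀ i ∈ s, H (a i) = b i by
    obtain ⟨H, hH, h⟩ := h Finset.univ
    exact ⟨H, hH, fun i => h i (Finset.mem_univ i)⟩
  intro s
  induction s using Finset.induction_on with
  | empty => exact ⟨_, IsMove.refl U, by simp⟩
  | insert j s hj ih =>
    obtain ⟨H, hH, hs⟩ := ih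
    have hF : (b '' s).Finite := s.finite_toSet.image b
    -- The next point travels in `U` minus the targets already reached, so these stay fixed.
    obtain ⟨K, hK, hKj⟩ := exists_isMove (hU.sdiff hF.isClosed)
      (isPreconnected_diff hU hc hF.countable) (x := H (a j)) (y := b j)
      ⟨hH.mem (haU j), by
        rintro ⟨i, hi, h⟩
        rw [← hs i hi] at h
        exact hj (ha (H.injective h) ▸ hi)⟩
      ⟨hbU j, by
        rintro ⟨i, hi, h⟩
        exact hj (hb h ▸ hi)⟩
    refine ⟨H.trans K, hH.trans (hK.mono sdiff_subset), fun i hi => ?_⟩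
    rcases Finset.mem_insert.1 hi with rfl | hi
    · exact hKj
    · rw [Homeomorph.trans_apply, hs i hi]
      exact hK.fixed _ fun h => h.2 ⟨i, hi, rfl⟩

/-! ### Loops in prescribed position with respect to finitely many points -/

theorem AffOn.of_eq {E : Type*} [AddCommGroup E] [Module ℝ E] {f : ℝ → E} {a b : ℝ} (hab : a < b)
    (p q : E) (h : ∀ t ∈ Icc a b, f t = p + t • q) : AffOn f a b := by
  intro c hc
  have hm : lineMap a b c ∈ Icc a b := (convex_Icc a b).lineMap_mem (left_mem_Icc.2 hab.le)
    (right_mem_Icc.2 hab.le) hc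
  rw [h _ hm, h a (left_mem_Icc.2 hab.le), h b (right_mem_Icc.2 hab.le)]
  simp only [lineMap_apply_module]
  module

/-- The parametrization of the taxicab circle of radius `r` around `c`. -/
noncomputable def diamond (c : Plane) (r t : ℝ) : Plane :=
  c + r • !₂[|4 * t - 2| - 1, |4 * t - 3| - |4 * t - 1| + 4 * t - 2]

theorem diamond_zero_coord (c : Plane) (r t : ℝ) :
    diamond c r t 0 = c 0 + r * (|4 * t - 2| - 1) := by simp [diamond]

theorem diamond_one_coord (c : Plane) (r t : ℝ) :
    diamond c r t 1 = c 1 + r * (|4 * t - 3| - |4 * t - 1| + 4 * t - 2) := by simp [diamond]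

theorem plOn_diamond (c : Plane) (r : ℝ) : PLOn (diamond c r) 0 1 := by
  have h1 : AffOn (diamond c r) 0 (1 / 4) := by
    refine .of_eq (by norm_num) (c + r • !₂[1, 0]) (r • !₂[-4, 4]) fun t ht => ?_
    rw [diamond, abs_of_nonpos (by linarith [ht.2] : 4 * t - 2 ≤ 0),
      abs_of_nonpos (by linarith [ht.2] : 4 * t - 3 ≤ 0),
      abs_of_nonpos (by linarith [ht.2] : 4 * t - 1 ≤ 0)]
    ext i; fin_cases i <;> simp <;> ring
  have h2 : AffOn (diamond c r) (1 / 4) (1 / 2) := by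
    refine .of_eq (by norm_num) (c + r • !₂[1, 2]) (r • !₂[-4, -4]) fun t ht => ?_
    rw [diamond, abs_of_nonpos (by linarith [ht.2] : 4 * t - 2 ≤ 0),
      abs_of_nonpos (by linarith [ht.2] : 4 * t - 3 ≤ 0),
      abs_of_nonneg (by linarith [ht.1] : 0 ≤ 4 * t - 1)]
    ext i; fin_cases i <;> simp <;> ring
  have h3 : AffOn (diamond c r) (1 / 2) (3 / 4) := by
    refine .of_eq (by norm_num) (c + r • !₂[-3, 2]) (r • !₂[4, -4]) fun t ht => ?_
    rw [diamond, abs_of_nonneg (by linarith [ht.1] : 0 ≤ 4 * t - 2),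
      abs_of_nonpos (by linarith [ht.2] : 4 * t - 3 ≤ 0),
      abs_of_nonneg (by linarith [ht.1] : 0 ≤ 4 * t - 1)]
    ext i; fin_cases i <;> simp <;> ring
  have h4 : AffOn (diamond c r) (3 / 4) 1 := by
    refine .of_eq (by norm_num) (c + r • !₂[-3, -4]) (r • !₂[4, 4]) fun t ht => ?_
    rw [diamond, abs_of_nonneg (by linarith [ht.1] : 0 ≤ 4 * t - 2),
      abs_of_nonneg (by linarith [ht.1] : 0 ≤ 4 * t - 3),
      abs_of_nonneg (by linarith [ht.1] : 0 ≤ 4 * t - 1)]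
    ext i; fin_cases i <;> simp <;> ring
  exact .snoc _ _ _ (.snoc _ _ _ (.snoc _ _ _ (.single _ _ (by norm_num) h1) (by norm_num) h2)
    (by norm_num) h3) (by norm_num) h4

theorem isPLLoop_diamond (c : Plane) {r : ℝ} (hr : 0 < r) : IsPLLoop (diamond c r) := by
  refine ⟨(plOn_diamond c r).isPiecewiseLinearOnUnit, by norm_num [diamond], ?_⟩
  intro s hs t ht h
  have h0 := congrArg (fun p : Plane => p 0) h
  have h1 := congrArg (fun p : Plane => p 1) h
  simp only [diamond_zero_coord, diamond_one_coord, add_right_inj,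
    mul_right_inj' hr.ne', sub_left_inj] at h0 h1
  obtain ⟨hs0, hs1⟩ := hs
  obtain ⟨ht0, ht1⟩ := ht
  rcases abs_cases (4 * s - 2) with a | a <;> rcases abs_cases (4 * t - 2) with b | b <;>
  rcases abs_cases (4 * s - 3) with c | c <;> rcases abs_cases (4 * t - 3) with d | d <;>
  rcases abs_cases (4 * s - 1) with e | e <;> rcases abs_cases (4 * t - 1) with f | f <;>
  linarith

theorem mem_diamond_iff (c : Plane) {r : ℝ} (hr : 0 < r) (x : Plane) :
    x ∈ diamond c r '' Icc 0 1 ↔ taxi c x = r := by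
  constructor
  · rintro ⟨t, ht, rfl⟩
    rw [taxi, diamond_zero_coord, diamond_one_coord, add_sub_cancel_left, add_sub_cancel_left,
      abs_mul, abs_mul, abs_of_pos hr, ← mul_add]
    convert mul_one r
    obtain ⟨ht0, ht1⟩ := ht
    rcases abs_cases (4 * t - 2) with a | a <;> rcases abs_cases (4 * t - 3) with c | c <;>
    rcases abs_cases (4 * t - 1) with e | e <;>
    rcases abs_cases (|4 * t - 2| - 1) with f | f <;>
    rcases abs_cases (|4 * t - 3| - |4 * t - 1| + 4 * t - 2) with g | g <;> linarith
  · intro h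
    set u := (x 0 - c 0) / r with hu
    set v := (x 1 - c 1) / r with hv
    have huv : |u| + |v| = 1 := by
      rw [hu, hv, abs_div, abs_div, abs_of_pos hr, ← add_div]
      exact (div_eq_one_iff_eq hr.ne').2 h
    have key : ∃ t ∈ Icc (0 : ℝ) 1, |4 * t - 2| - 1 = u ∧
        |4 * t - 3| - |4 * t - 1| + 4 * t - 2 = v := by
      -- On the upper half `u = 1 - 4 * t`, on the lower half `u = 4 * t - 3`.
      rcases le_total 0 v with h0 | h0
      · rw [abs_of_nonneg h0] at huv
        have := abs_le.1 (show |u| ≤ 1 by linarith)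
        refine ⟨(1 - u) / 4, ⟨by linarith, by linarith⟩, ?_, ?_⟩
        · rw [abs_of_nonpos (by linarith)]; ring
        · rw [abs_of_nonpos (by linarith)]
          rcases abs_cases u with a | a
          · rw [abs_of_nonpos (by linarith)]; linarith
          · rw [abs_of_nonneg (by linarith)]; linarith
      · rw [abs_of_nonpos h0] at huv
        have := abs_le.1 (show |u| ≤ 1 by linarith)
        refine ⟨(3 + u) / 4, ⟨by linarith, by linarith⟩, ?_, ?_⟩
        · rw [abs_of_nonneg (by linarith)]; ring
        · rw [abs_of_nonneg (by linarith : 0 ≤ 4 * ((3 + u) / 4) - 1)]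
          rcases abs_cases u with a | a
          · rw [abs_of_nonneg (by linarith)]; linarith
          · rw [abs_of_nonpos (by linarith)]; linarith
    obtain ⟨t, ht, h1, h2⟩ := key
    refine ⟨t, ht, ?_⟩
    ext i; fin_cases i
    · simp only [Fin.zero_eta, diamond_zero_coord, h1, hu]; field_simp; ring
    · simp only [Fin.mk_one, diamond_one_coord, h2, hv]; field_simp; ring

theorem convex_taxi_lt (c : Plane) (r : ℝ) : Convex ℝ {x | taxi c x < r} := by
  have h : ConvexOn ℝ univ (taxi c) := by
    refine ⟨convex_univ, fun x _ y _ a b ha hb hab => ?_⟩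
    have e : ∀ i, (a • x + b • y) i - c i = a * (x i - c i) + b * (y i - c i) := fun i => by
      simp only [PiLp.add_apply, PiLp.smul_apply, smul_eq_mul]
      linear_combination c i * hab
    have e' : ∀ i, |(a • x + b • y) i - c i| ≤ a * |x i - c i| + b * |y i - c i| := fun i => by
      rw [e]
      refine (abs_add_le _ _).trans ?_
      rw [abs_mul, abs_mul, abs_of_nonneg ha, abs_of_nonneg hb]
    simp only [taxi, smul_eq_mul]
    linarith [e' 0, e' 1]
  simpa using h.convex_lt r

/-- Hall's theorem, applied to subsets with as many elements as `ι`. -/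
theorem exists_injective_mem {ι α : Type*} [Finite ι] {S : ι → Set α} (hS : ∀ i, (S i).Infinite) :
    ∃ a : ι → α, Function.Injective a ∧ ∀ i, a i ∈ S i := by
  classical
  cases nonempty_fintype ι
  choose t ht hcard using fun i => (hS i).exists_subset_card_eq (Fintype.card ι)
  obtain ⟨a, ha, hat⟩ := (Finset.all_card_le_biUnion_card_iff_exists_injective t).1 fun s => by
    rcases s.eq_empty_or_nonempty with rfl | ⟨i, hi⟩
    · simp
    · exact (Finset.card_le_univ s).trans
        ((hcard i).symm.le.trans (Finset.card_le_card (Finset.subset_biUnion_of_mem t hi)))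
  exact ⟨a, ha, fun i => ht i (hat i)⟩

/-- In a connected open set there is a piecewise linear simple closed curve, the zero set of a
function `g`, such that each of finitely many points lies on it, inside or outside, as
prescribed. -/
theorem exists_isPLLoop_sign {U : Set Plane} (hU : IsOpenConnected U) {ι : Type*} [Finite ι]
    {P : ι → Plane} (hP : Function.Injective P) (hPU : ∀ i, P i ∈ U) (k : ι → SignType) :
    ∃ (f : ℝ → Plane) (g : Plane → ℝ), IsPLLoop f ∧ f '' Icc 0 1 ⊆ U ∧ Continuous g ∧
      (∀ x, x ∈ f '' Icc 0 1 ↔ g x = 0) ∧ (∀ i, SignType.sign (g (P i)) = k i) ∧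
      IsSimplyConnected {x | g x < 0} ∧ {x | g x < 0} ⊆ U := by
  obtain ⟨c, hc⟩ := hU.2.nonempty
  obtain ⟨R, hR, hRU⟩ := Metric.isOpen_iff.1 hU.1 c hc
  -- This leaves room in the ball of radius `R` for points outside the taxicab circle of radius `r`.
  set r := R / 4 with hr
  have hr0 : 0 < r := by positivity
  have hrU : ∀ x, taxi c x ≤ r → x ∈ U := fun x hx => hRU (by
    rw [Metric.mem_ball, dist_eq_norm]
    linarith [norm_sub_le_taxi c x])
  have hinf : ∀ s : SignType, {x | x ∈ U ∧ SignType.sign (taxi c x - r) = s}.Infinite := by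
    intro s
    rcases s.trichotomy with rfl | rfl | rfl
    · refine infinite_of_mem_nhds c ?_
      filter_upwards [hU.1.mem_nhds hc, (isOpen_lt (continuous_taxi c) continuous_const).mem_nhds
        (show taxi c c < r by simpa [taxi])] with x hx hx'
      exact ⟨hx, sign_neg (sub_neg.2 hx')⟩
    · have := (Ico_infinite (zero_lt_one' ℝ)).image (isPLLoop_diamond c hr0).injOn
      refine this.mono fun x hx => ?_
      have h := (mem_diamond_iff c hr0 x).1 (image_mono Ico_subset_Icc_self hx)
      exact ⟨hrU x h.le, by rw [h, sub_self, sign_zero]⟩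
    · set y : Plane := c + !₂[2 * r, 0] with hy
      have hyr : taxi c y = 2 * r := by
        simp [taxi, hy, abs_of_pos hr0]
      have hyU : y ∈ U := hRU (by
        rw [Metric.mem_ball, dist_eq_norm]
        linarith [norm_sub_le_taxi c y])
      refine infinite_of_mem_nhds y ?_
      filter_upwards [hU.1.mem_nhds hyU, (isOpen_lt continuous_const (continuous_taxi c)).mem_nhds
        (show r < taxi c y by linarith)] with x hx hx'
      exact ⟨hx, sign_pos (sub_pos.2 hx')⟩
  -- Points with the right signs for the small circle are chosen first; the homeomorphism taking
  -- them to `P` then transports the circle and its defining function.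
  obtain ⟨a, ha, haS⟩ := exists_injective_mem fun i => hinf (k i)
  obtain ⟨H, hH, hHa⟩ := exists_isMove_finite hU.1 hU.2.isPreconnected ha hP
    (fun i => (haS i).1) hPU
  have hset : {x | taxi c (H.symm x) - r < 0} = H '' {x | taxi c x < r} := by
    rw [Homeomorph.image_eq_preimage_symm]; ext x; simp
  refine ⟨fun t => H (diamond c r t), fun x => taxi c (H.symm x) - r,
    hH.isPLLoop (isPLLoop_diamond c hr0), ?_, ?_, fun x => ?_, fun i => ?_, ?_, ?_⟩
  · rintro _ ⟨t, ht, rfl⟩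
    exact hH.mem (hrU _ ((mem_diamond_iff c hr0 _).1 ⟨t, ht, rfl⟩).le)
  · exact ((continuous_taxi c).comp H.symm.continuous).sub continuous_const
  · rw [sub_eq_zero, ← mem_diamond_iff c hr0, ← image_image H, Homeomorph.image_eq_preimage_symm]
    rfl
  · simpa [← hHa] using (haS i).2
  · rw [hset, Homeomorph.isSimplyConnected_image]
    have : ContractibleSpace {x | taxi c x < r} :=
      (convex_taxi_lt c r).contractibleSpace ⟨c, by simpa [taxi]⟩
    exact inferInstanceAs (SimplyConnectedSpace {x | taxi c x < r})
  · rw [hset]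
    rintro _ ⟨x, hx, rfl⟩
    exact hH.mem (hrU x (le_of_lt hx))

/-! ### Polygons near their points -/

/-- The determinant of two vectors of the plane. -/
def cross (d x : Plane) : ℝ := d 0 * x 1 - d 1 * x 0

theorem cross_add (d x y : Plane) : cross d (x + y) = cross d x + cross d y := by
  simp [cross]; ring

theorem cross_sub (d x y : Plane) : cross d (x - y) = cross d x - cross d y := by
  simp [cross]; ring

theorem cross_smul (d : Plane) (s : ℝ) (x : Plane) : cross d (s • x) = s * cross d x := by
  simp [cross]; ring

theorem cross_self (d : Plane) : cross d d = 0 := by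
  simp [cross]; ring

theorem continuous_cross (d : Plane) : Continuous (cross d) := by
  unfold cross; fun_prop

theorem sum_sq_pos {d : Plane} (hd : d ≠ 0) : 0 < d 0 ^ 2 + d 1 ^ 2 := by
  by_contra! h
  apply hd
  ext i
  fin_cases i <;> simp <;> nlinarith [sq_nonneg (d 0), sq_nonneg (d 1)]

theorem eq_smul_of_cross_eq_zero {d x : Plane} (hd : d ≠ 0) (h : cross d x = 0) :
    x = ((d 0 * x 0 + d 1 * x 1) / (d 0 ^ 2 + d 1 ^ 2)) • d := by
  have hp := (sum_sq_pos hd).ne'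
  unfold cross at h
  ext i
  fin_cases i
  · simp; field_simp; linear_combination (-d 1) * h
  · simp; field_simp; linear_combination (d 0) * h

theorem exists_cross_ne_zero {d : Plane} (hd : d ≠ 0) : ∃ e, cross d e ≠ 0 := by
  refine ⟨!₂[-d 1, d 0], ?_⟩
  have := sum_sq_pos hd
  simp only [cross, Matrix.cons_val_zero, Matrix.cons_val_one]
  nlinarith

theorem eq_zero_of_cross_eq_zero {d e x : Plane} (h : cross d e ≠ 0) (h1 : cross d x = 0)
    (h2 : cross e x = 0) : x = 0 := by
  unfold cross at *
  ext i
  fin_cases i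
  · refine (mul_eq_zero.1 (?_ : (d 0 * e 1 - d 1 * e 0) * x 0 = 0)).resolve_left h
    linear_combination e 0 * h1 - d 0 * h2
  · refine (mul_eq_zero.1 (?_ : (d 0 * e 1 - d 1 * e 0) * x 1 = 0)).resolve_left h
    linear_combination e 1 * h1 - d 1 * h2

/-- The polygonal path `f` has its breaks at the points `t 0 = 0 < ⋯ < t n = 1`. -/
structure IsSubdivision (f : ℝ → Plane) (n : ℕ) (t : ℕ → ℝ) : Prop where
  zero : t 0 = 0
  last : t n = 1
  step : ∀ i < n, t i < t (i + 1) ∧ AffOn f (t i) (t (i + 1))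

theorem IsPLLoop.exists_isSubdivision {f : ℝ → Plane} (hf : IsPLLoop f) :
    ∃ n t, IsSubdivision f n t := by
  obtain ⟨n, t, h0, hn, h⟩ := hf.pl
  exact ⟨n, t, h0, hn, h⟩

/-- The direction of the `i`-th edge of a polygonal path. -/
def edge (f : ℝ → Plane) (t : ℕ → ℝ) (i : ℕ) : Plane := f (t (i + 1)) - f (t i)

namespace IsSubdivision

variable {f : ℝ → Plane} {n : ℕ} {t : ℕ → ℝ}

theorem mono (h : IsSubdivision f n t) {i j : ℕ} (hij : i ≤ j) (hj : j ≤ n) : t i ≤ t j := by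
  induction j, hij using Nat.le_induction with
  | base => exact le_rfl
  | succ j _ ih => exact (ih (by omega)).trans (h.step j (by omega)).1.le

theorem mem (h : IsSubdivision f n t) {i : ℕ} (hi : i ≤ n) : t i ∈ Icc (0 : ℝ) 1 :=
  ⟨h.zero ▸ h.mono (Nat.zero_le i) hi, h.last ▸ h.mono hi le_rfl⟩

theorem exists_piece (h : IsSubdivision f n t) {x : ℝ} (hx : x ∈ Icc (0 : ℝ) 1) :
    ∃ i < n, x ∈ Icc (t i) (t (i + 1)) := by
  have key : ∀ m, x ≤ t (m + 1) → ∃ i ≤ m, x ∈ Icc (t i) (t (i + 1)) := by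
    intro m
    induction m with
    | zero => exact fun hm => ⟨0, le_rfl, h.zero ▸ hx.1, hm⟩
    | succ m ih =>
      intro hm
      rcases le_total x (t (m + 1)) with h1 | h1
      · obtain ⟨i, hi, hx⟩ := ih h1
        exact ⟨i, by omega, hx⟩
      · exact ⟨m + 1, le_rfl, h1, hm⟩
  have hn : n ≠ 0 := by
    rintro rfl
    exact zero_ne_one (h.zero.symm.trans h.last)
  obtain ⟨m, rfl⟩ := Nat.exists_eq_succ_of_ne_zero hn
  obtain ⟨i, hi, hxi⟩ := key m (h.last.symm ▸ hx.2)
  exact ⟨i, by omega, hxi⟩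

theorem apply_eq (h : IsSubdivision f n t) {i : ℕ} (hi : i < n) {x : ℝ}
    (hx : x ∈ Icc (t i) (t (i + 1))) :
    f x = f (t i) + ((x - t i) / (t (i + 1) - t i)) • edge f t i := by
  rw [(h.step i hi).2.eq_on (h.step i hi).1 hx, lineMap_apply, edge, vsub_eq_sub, vadd_eq_add,
    add_comm]

theorem edge_ne_zero (h : IsSubdivision f n t) (hf : IsPLLoop f) {i : ℕ} (hi : i < n) :
    edge f t i ≠ 0 := by
  intro h0
  have hlt := (h.step i hi).1
  have hm := h.apply_eq hi (x := (t i + t (i + 1)) / 2) ⟨by linarith, by linarith⟩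
  rw [h0, smul_zero, add_zero] at hm
  have m0 := (h.mem hi.le).1
  have m1 := (h.mem (Nat.succ_le_of_lt hi)).2
  have := hf.injOn ⟨by linarith, by linarith⟩ ⟨m0, by linarith⟩ hm
  linarith

theorem cross_edge_eq_zero (h : IsSubdivision f n t) {i : ℕ} (hi : i < n) {x : ℝ}
    (hx : x ∈ Icc (t i) (t (i + 1))) : cross (edge f t i) (f x - f (t i)) = 0 := by
  rw [h.apply_eq hi hx, add_sub_cancel_left, cross_smul, cross_self, mul_zero]

theorem exists_cross_eq_zero (h : IsSubdivision f n t) {p : Plane} (hp : p ∈ f '' Icc 0 1) :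
    ∃ i < n, cross (edge f t i) (p - f (t i)) = 0 := by
  obtain ⟨x, hx, rfl⟩ := hp
  obtain ⟨i, hi, hxi⟩ := h.exists_piece hx
  exact ⟨i, hi, h.cross_edge_eq_zero hi hxi⟩

/-- Near a point that is not a vertex, a polygon is a straight line. -/
theorem exists_local_line (h : IsSubdivision f n t) (hf : IsPLLoop f) {p : Plane}
    (hp : p ∈ f '' Icc 0 1) (hv : ∀ i ≤ n, p ≠ f (t i)) :
    ∃ i < n, cross (edge f t i) (p - f (t i)) = 0 ∧
      ∀ᶠ q in 𝓝 p, q ∈ f '' Icc 0 1 ↔ cross (edge f t i) (q - p) = 0 := by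
  obtain ⟨x, hx, rfl⟩ := hp
  obtain ⟨i, hi, hxi⟩ := h.exists_piece hx
  have hline := h.cross_edge_eq_zero hi hxi
  have hlt := (h.step i hi).1
  have hti := h.mem hi.le
  have htj := h.mem (Nat.succ_le_of_lt hi)
  have hx0 : t i < x := hxi.1.lt_of_ne fun e => hv i hi.le (e ▸ rfl)
  have hx1 : x < t (i + 1) := hxi.2.lt_of_ne fun e => hv (i + 1) hi (e ▸ rfl)
  set d := edge f t i with hd
  have hd0 : d ≠ 0 := h.edge_ne_zero hf hi
  -- The rest of the polygon is compact and misses `f x`, so near `f x` only the `i`-th edge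
  -- matters.
  set K := f '' (Icc 0 (t i) ∪ Icc (t (i + 1)) 1) with hK
  have hsub : Icc 0 (t i) ∪ Icc (t (i + 1)) 1 ⊆ Icc (0 : ℝ) 1 :=
    union_subset (Icc_subset_Icc_right hti.2) (Icc_subset_Icc_left htj.1)
  have hKc : IsClosed K :=
    ((isCompact_Icc.union isCompact_Icc).image_of_continuousOn
      (hf.continuousOn.mono hsub)).isClosed
  have hxK : f x ∉ K := by
    rintro ⟨y, hy, hyx⟩
    have hyI := hsub hy
    rcases hyI.2.eq_or_lt with rfl | hy1
    · exact hv 0 (Nat.zero_le n) (by rw [h.zero, hf.closed, hyx])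
    · have : y = x := hf.injOn ⟨hyI.1, hy1⟩ ⟨hx.1, hx1.trans_le htj.2⟩ hyx
      subst this
      rcases hy with hy | hy
      · exact absurd hy.2 (not_le.2 hx0)
      · exact absurd hy.1 (not_le.2 hx1)
  -- The coordinate along the edge, equal to 0 and 1 at its ends.
  set σ : Plane → ℝ := fun q =>
    (d 0 * (q - f (t i)) 0 + d 1 * (q - f (t i)) 1) / (d 0 ^ 2 + d 1 ^ 2) with hσ
  have hσc : Continuous σ := by
    rw [hσ]
    simp only [PiLp.sub_apply]
    fun_prop
  have hσx : σ (f x) ∈ Ioo (0 : ℝ) 1 := by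
    have e : σ (f x) = (x - t i) / (t (i + 1) - t i) := by
      have := sum_sq_pos hd0
      rw [hσ]
      simp only
      rw [h.apply_eq hi hxi, add_sub_cancel_left, ← hd]
      simp only [PiLp.smul_apply, smul_eq_mul]
      have : t (i + 1) - t i ≠ 0 := by linarith
      field_simp
    rw [e]
    exact ⟨div_pos (by linarith) (by linarith), (div_lt_one (by linarith)).2 (by linarith)⟩
  refine ⟨i, hi, hline, ?_⟩
  filter_upwards [hKc.isOpen_compl.mem_nhds hxK,
    hσc.continuousAt.eventually (isOpen_Ioo.mem_nhds hσx)] with q hqK hqσ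
  have hcr : cross d (q - f x) = cross d (q - f (t i)) := by
    rw [cross_sub] at hline
    rw [cross_sub, cross_sub]; linarith
  rw [hcr]
  constructor
  · rintro ⟨y, hy, rfl⟩
    refine h.cross_edge_eq_zero hi ⟨?_, ?_⟩
    · by_contra! hlt
      exact hqK ⟨y, .inl ⟨hy.1, hlt.le⟩, rfl⟩
    · by_contra! hlt
      exact hqK ⟨y, .inr ⟨hlt.le, hy.2⟩, rfl⟩
  · intro h0
    refine ⟨lineMap (t i) (t (i + 1)) (σ q), (convex_Icc (0 : ℝ) 1).lineMap_mem hti htj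
      ⟨hqσ.1.le, hqσ.2.le⟩, ?_⟩
    rw [(h.step i hi).2 _ ⟨hqσ.1.le, hqσ.2.le⟩, lineMap_apply, vsub_eq_sub, vadd_eq_add]
    exact (sub_eq_iff_eq_add.1 (eq_smul_of_cross_eq_zero hd0 h0)).symm

end IsSubdivision

/-- Two sets that near `p` are two different lines through `p` cross properly there. -/
theorem crossProperlyAt_of_lines {A B : Set Plane} {p d e : Plane} (hde : cross d e ≠ 0)
    (hA : ∀ᶠ q in 𝓝 p, q ∈ A ↔ cross d (q - p) = 0)
    (hB : ∀ᶠ q in 𝓝 p, q ∈ B ↔ cross e (q - p) = 0) : CrossProperlyAt A B p := by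
  -- The form of `e` comes first: `A`, the line of direction `d`, must become the zero set of
  -- coordinate 1.
  let L : Plane →ₗ[ℝ] Plane :=
    { toFun := fun x => !₂[cross e x, cross d x]
      map_add' := fun x y => by ext i; fin_cases i <;> simp [cross_add]
      map_smul' := fun s x => by ext i; fin_cases i <;> simp [cross_smul] }
  have hL : Function.Injective L := by
    rw [← LinearMap.ker_eq_bot, LinearMap.ker_eq_bot']
    intro x hx
    exact eq_zero_of_cross_eq_zero hde (by simpa [L] using congrArg (fun y : Plane => y 1) hx)
      (by simpa [L] using congrArg (fun y : Plane => y 0) hx)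
  let h : Plane ≃ₜ Plane := (Homeomorph.subRight p).trans
    (LinearEquiv.ofInjectiveEndo L hL).toContinuousLinearEquiv.toHomeomorph
  have hh : ∀ q, h q = !₂[cross e (q - p), cross d (q - p)] := fun q => rfl
  obtain ⟨W, hW, hWo, hpW⟩ := eventually_nhds_iff.1 (hA.and hB)
  refine ⟨h.toOpenPartialHomeomorph.restrOpen W hWo, by simpa using hpW, ?_, fun q hq => ?_⟩
  · change h p = 0
    ext i; fin_cases i <;> simp [hh, cross]
  · have hqW : q ∈ W := by simpa using hq
    change (q ∈ A ↔ h q 1 = 0) ∧ (q ∈ B ↔ h q 0 = 0)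
    simpa [hh] using hW q hqW

/-! ### Polygons in general position -/

/-- For a common point `z` of three lines with directions `d₁`, `d₂`, `d₃`, this is a linear
relation between their offsets `cross dᵢ z`; concurrency is excluded by violating it. -/
theorem cross_smul_eq (d₁ d₂ d₃ z : Plane) :
    cross d₁ d₂ * cross d₃ z = cross d₃ d₂ * cross d₁ z + cross d₁ d₃ * cross d₂ z := by
  unfold cross; ring

/-- Loops are in general position if no vertex of one of them is on the line of an edge of another
one, and there are no concurrent lines of edges of three different loops. -/
theorem isInGeneralPosition_of_lines {V : Type*} {f : V → ℝ → Plane} (hf : ∀ v, IsPLLoop (f v))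
    {n : V → ℕ} {t : V → ℕ → ℝ} (ht : ∀ v, IsSubdivision (f v) (n v) (t v))
    (hvert : ∀ u v, u ≠ v → ∀ i j, j < n v →
      cross (edge (f v) (t v) j) (f u (t u i) - f v (t v j)) ≠ 0)
    (htriple : ∀ u v x, u ≠ v → u ≠ x → v ≠ x → ∀ i j k, k < n x →
      cross (edge (f u) (t u) i) (edge (f v) (t v) j) ≠ 0 →
      cross (edge (f u) (t u) i) (edge (f v) (t v) j) *
        cross (edge (f x) (t x) k) (f x (t x k)) ≠
      cross (edge (f x) (t x) k) (edge (f v) (t v) j) *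
          cross (edge (f u) (t u) i) (f u (t u i)) +
        cross (edge (f u) (t u) i) (edge (f x) (t x) k) *
          cross (edge (f v) (t v) j) (f v (t v j))) :
    IsInGeneralPosition (fun v => f v '' Icc 0 1) ∧ ∀ u v, u ≠ v → f u 0 ∉ f v '' Icc 0 1 := by
  have hnv : ∀ u v, u ≠ v → ∀ i, f u (t u i) ∉ f v '' Icc 0 1 := by
    intro u v huv i hmem
    obtain ⟨j, hj, h⟩ := (ht v).exists_cross_eq_zero hmem
    exact hvert u v huv i j hj h
  -- Parallel edge lines with a common point coincide, and then a vertex of one loop is on an edge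
  -- line of the other.
  have hnp : ∀ u v, u ≠ v → ∀ i < n u, ∀ j < n v, ∀ p,
      cross (edge (f u) (t u) i) (p - f u (t u i)) = 0 →
      cross (edge (f v) (t v) j) (p - f v (t v j)) = 0 →
      cross (edge (f u) (t u) i) (edge (f v) (t v) j) ≠ 0 := by
    intro u v huv i hi j hj p h1 h2 h0
    apply hvert u v huv i j hj
    have e := eq_smul_of_cross_eq_zero ((ht u).edge_ne_zero (hf u) hi) h1
    have h3 : cross (edge (f v) (t v) j) (edge (f u) (t u) i) = 0 := by
      unfold cross at h0 ⊢; linarith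
    have h4 : cross (edge (f v) (t v) j) (p - f u (t u i)) = 0 := by
      rw [e, cross_smul, h3, mul_zero]
    rw [cross_sub] at h2 h4 ⊢
    linarith
  refine ⟨⟨fun u v huv => ?_, fun u v x huv hux hvx => ?_, fun u v huv p hp => ?_⟩,
    fun u v huv => (ht u).zero ▸ hnv u v huv 0⟩
  · have hsub : f u '' Icc 0 1 ∩ f v '' Icc 0 1 ⊆ ⋃ i ∈ Iio (n u), ⋃ j ∈ Iio (n v),
        {p | cross (edge (f u) (t u) i) (p - f u (t u i)) = 0 ∧
          cross (edge (f v) (t v) j) (p - f v (t v j)) = 0} := by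
      rintro p ⟨h1, h2⟩
      obtain ⟨i, hi, hpi⟩ := (ht u).exists_cross_eq_zero h1
      obtain ⟨j, hj, hpj⟩ := (ht v).exists_cross_eq_zero h2
      exact mem_biUnion hi (mem_biUnion hj ⟨hpi, hpj⟩)
    refine Finite.subset ?_ hsub
    refine (finite_Iio _).biUnion fun i hi => (finite_Iio _).biUnion fun j hj =>
      Set.Subsingleton.finite ?_
    rintro p ⟨hp1, hp2⟩ q ⟨hq1, hq2⟩
    have hD := hnp u v huv i hi j hj p hp1 hp2
    rw [cross_sub] at hp1 hp2 hq1 hq2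
    refine sub_eq_zero.1 (eq_zero_of_cross_eq_zero hD ?_ ?_) <;> rw [cross_sub] <;> linarith
  · rw [eq_empty_iff_forall_notMem]
    rintro p ⟨⟨h1, h2⟩, h3⟩
    obtain ⟨i, hi, hpi⟩ := (ht u).exists_cross_eq_zero h1
    obtain ⟨j, hj, hpj⟩ := (ht v).exists_cross_eq_zero h2
    obtain ⟨k, hk, hpk⟩ := (ht x).exists_cross_eq_zero h3
    apply htriple u v x huv hux hvx i j k hk (hnp u v huv i hi j hj p hpi hpj)
    rw [cross_sub, sub_eq_zero] at hpi hpj hpk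
    rw [← hpi, ← hpj, ← hpk, cross_smul_eq]
  · obtain ⟨i, hi, hpi, hloc⟩ := (ht u).exists_local_line (hf u) hp.1
      fun i _ e => hnv u v huv i (e ▸ hp.2)
    obtain ⟨j, hj, hpj, hloc'⟩ := (ht v).exists_local_line (hf v) hp.2
      fun j _ e => hnv v u huv.symm j (e ▸ hp.1)
    exact crossProperlyAt_of_lines (hnp u v huv i hi j hj p hpi hpj) hloc hloc'

/-- The zero set of `L` is closed, and moving along `e`, where `L` has slope `κ`, leaves it at once.
-/
theorem eventually_residual_ne_zero {E : Type*} [AddCommGroup E] [Module ℝ E]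
    [TopologicalSpace E] [ContinuousAdd E] [ContinuousSMul ℝ E] {L : E → ℝ} (hL : Continuous L)
    {e : E} {κ : ℝ} (hκ : κ ≠ 0) (h : ∀ w s, L (w + s • e) = L w + s * κ) :
    ∀ᶠ w in residual E, L w ≠ 0 := by
  refine residual_of_dense_open (isOpen_ne_fun hL continuous_const) fun w => ?_
  by_cases hw : L w = 0
  · have ht : Tendsto (fun s : ℝ => w + s • e) (𝓝[≠] 0) (𝓝 w) := by
      have : Continuous fun s : ℝ => w + s • e := by fun_prop
      simpa using (this.tendsto 0).mono_left nhdsWithin_le_nhds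
    refine mem_closure_of_tendsto ht ?_
    filter_upwards [self_mem_nhdsWithin] with s hs
    rw [h, hw, zero_add]
    exact mul_ne_zero hs hκ
  · exact subset_closure hw

theorem IsPLLoop.add_const {f : ℝ → Plane} (hf : IsPLLoop f) (w : Plane) :
    IsPLLoop (fun s => f s + w) := by
  obtain ⟨n, t, h⟩ := hf.exists_isSubdivision
  refine ⟨⟨n, t, h.zero, h.last, fun i hi => ⟨(h.step i hi).1, fun c hc => ?_⟩⟩,
    congrArg (· + w) hf.closed, fun a ha b hb hab => hf.injOn ha hb (add_right_cancel hab)⟩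
  simp only
  rw [(h.step i hi).2 c hc, lineMap_apply_module, lineMap_apply_module]
  module

theorem IsSubdivision.add_const {f : ℝ → Plane} {n : ℕ} {t : ℕ → ℝ} (h : IsSubdivision f n t)
    (w : Plane) : IsSubdivision (fun s => f s + w) n t := by
  refine ⟨h.zero, h.last, fun i hi => ⟨(h.step i hi).1, fun c hc => ?_⟩⟩
  simp only
  rw [(h.step i hi).2 c hc, lineMap_apply_module, lineMap_apply_module]
  module

/-- Generic translates of loops are in general position. -/
theorem eventually_residual_isInGeneralPosition {V : Type*} [Finite V] {f : V → ℝ → Plane}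
    (hf : ∀ v, IsPLLoop (f v)) : ∀ᶠ w : V → Plane in residual (V → Plane),
      IsInGeneralPosition (fun v => (fun s => f v s + w v) '' Icc 0 1) ∧
      ∀ u v, u ≠ v → f u 0 + w u ∉ (fun s => f v s + w v) '' Icc 0 1 := by
  classical
  choose n t ht using fun v => (hf v).exists_isSubdivision
  have hedge : ∀ (w : V → Plane) v i, edge (fun s => f v s + w v) (t v) i = edge (f v) (t v) i :=
    fun w v i => add_sub_add_right_eq_sub _ _ _
  have hcc : ∀ (d : Plane) v, Continuous fun w : V → Plane => cross d (w v) := fun d v =>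
    (continuous_cross d).comp (continuous_apply v)
  have h1 : ∀ᶠ w : V → Plane in residual (V → Plane), ∀ u v, u ≠ v → ∀ i j, j < n v →
      cross (edge (f v) (t v) j) (f u (t u i) + w u - (f v (t v j) + w v)) ≠ 0 := by
    simp only [eventually_countable_forall]
    intro u v huv i j hj
    obtain ⟨e, he⟩ := exists_cross_ne_zero ((ht v).edge_ne_zero (hf v) hj)
    -- Translate loop `u` alone, transversally to the edge of loop `v`.
    refine eventually_residual_ne_zero (e := Pi.single u e) ?_ he fun w s => ?_
    · simp only [cross_sub, cross_add]
      have := hcc (edge (f v) (t v) j) u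
      have := hcc (edge (f v) (t v) j) v
      fun_prop
    · simp only [cross_sub, cross_add, Pi.add_apply, Pi.smul_apply, Pi.single_eq_same,
        Pi.single_eq_of_ne huv.symm, cross_smul]
      simp [cross]
      ring
  have h2 : ∀ᶠ w : V → Plane in residual (V → Plane), ∀ u v x, u ≠ v → u ≠ x → v ≠ x →
      ∀ i j k, k < n x → cross (edge (f u) (t u) i) (edge (f v) (t v) j) ≠ 0 →
      cross (edge (f u) (t u) i) (edge (f v) (t v) j) *
        cross (edge (f x) (t x) k) (f x (t x k) + w x) -
      (cross (edge (f x) (t x) k) (edge (f v) (t v) j) *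
          cross (edge (f u) (t u) i) (f u (t u i) + w u) +
        cross (edge (f u) (t u) i) (edge (f x) (t x) k) *
          cross (edge (f v) (t v) j) (f v (t v j) + w v)) ≠ 0 := by
    simp only [eventually_countable_forall]
    intro u v x huv hux hvx i j k hk hD
    obtain ⟨e, he⟩ := exists_cross_ne_zero ((ht x).edge_ne_zero (hf x) hk)
    -- Translating loop `x` alone changes only the first term, at rate `D * cross d e`, where `D` is
    -- the nonzero determinant of the other two directions and `d` the edge of `x`.
    refine eventually_residual_ne_zero (e := Pi.single x e) ?_ (mul_ne_zero hD he) fun w s => ?_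
    · simp only [cross_add]
      have := hcc (edge (f u) (t u) i) u
      have := hcc (edge (f v) (t v) j) v
      have := hcc (edge (f x) (t x) k) x
      fun_prop
    · have h0 : ∀ d : Plane, cross d (s • 0) = 0 := fun d => by simp [cross]
      simp only [cross_add, Pi.add_apply, Pi.smul_apply, Pi.single_eq_same,
        Pi.single_eq_of_ne hux, Pi.single_eq_of_ne hvx, h0, cross_smul]
      ring
  filter_upwards [h1, h2] with w hw1 hw2
  refine isInGeneralPosition_of_lines (f := fun v s => f v s + w v)
    (fun v => (hf v).add_const _) (fun v => (ht v).add_const _) ?_ ?_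
  · simpa only [hedge] using hw1
  · simpa only [hedge, sub_ne_zero] using hw2

/-! ### Passing between the families -/

theorem IsIntersectionGraph.mono {V : Type*} {G : SimpleGraph V} {F F' : Set Plane → Prop}
    (h : ∀ A, F A → F' A) : IsIntersectionGraph F G → IsIntersectionGraph F' G :=
  fun ⟨A, hA, hrep⟩ => ⟨A, fun v => h _ (hA v), hrep⟩

theorem HasGeneralPositionRep.mono {V : Type*} {G : SimpleGraph V} {F F' : Set Plane → Prop}
    (h : ∀ A, F A → F' A) : HasGeneralPositionRep F G → HasGeneralPositionRep F' G :=
  fun ⟨A, hA, hrep⟩ => ⟨A, fun v => h _ (hA v), hrep⟩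

theorem HasGeneralPositionRep.isIntersectionGraph {V : Type*} {G : SimpleGraph V}
    {F : Set Plane → Prop} : HasGeneralPositionRep F G → IsIntersectionGraph F G :=
  fun ⟨A, hA, hrep, _⟩ => ⟨A, hA, hrep⟩

theorem IsSimpleCurve.isCurve {A : Set Plane} : IsSimpleCurve A → IsCurve A :=
  fun ⟨f, hf, h⟩ => ⟨f, hf.continuous, h⟩

theorem IsCurve.isPathConnected {A : Set Plane} : IsCurve A → IsPathConnected A := by
  rintro ⟨f, hf, rfl⟩
  have := isPathConnected_iff_pathConnectedSpace.1
    ((convex_Icc (0 : ℝ) 1).isPathConnected ⟨0, by simp⟩)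
  exact isPathConnected_range hf

theorem IsSimpleClosedCurve.isPathConnected {A : Set Plane} :
    IsSimpleClosedCurve A → IsPathConnected A := by
  rintro ⟨f, hf, rfl⟩
  have : IsPathConnected (range Circle.exp) := isPathConnected_range Circle.exp.continuous
  rw [(show Function.Surjective Circle.exp from fun z => ⟨_, Circle.exp_arg z⟩).range_eq] at this
  rw [← image_univ]
  exact this.image hf.continuous

theorem IsArcwiseConnected.isPathConnected {A : Set Plane} (h : IsArcwiseConnected A) :
    IsPathConnected A := by
  refine isPathConnected_iff.2 ⟨h.1, fun x hx y hy => ?_⟩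
  by_cases hxy : x = y
  · exact hxy ▸ JoinedIn.refl hx
  · obtain ⟨f, hf, h0, h1, hfA⟩ := h.2 x hx y hy hxy
    exact ⟨⟨⟨f, hf.continuous⟩, h0, h1⟩, fun t => hfA ⟨t, rfl⟩⟩

theorem IsSimpleCurve.isArcwiseConnected {A : Set Plane} :
    IsSimpleCurve A → IsArcwiseConnected A := by
  rintro ⟨f, hf, rfl⟩
  refine ⟨range_nonempty f, ?_⟩
  rintro _ ⟨s, rfl⟩ _ ⟨t, rfl⟩ hst
  have hne : (s : ℝ) ≠ t := fun h => hst (congrArg f (Subtype.ext h))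
  let φ : unitInterval → unitInterval := fun c =>
    ⟨lineMap (s : ℝ) (t : ℝ) (c : ℝ), (convex_Icc (0 : ℝ) 1).lineMap_mem s.2 t.2 c.2⟩
  have hφ : Continuous φ := by
    refine Continuous.subtype_mk ?_ _
    simp only [lineMap_apply_module]
    fun_prop
  have hinj : Function.Injective φ := fun a b hab => by
    have := congrArg Subtype.val hab
    exact Subtype.ext (lineMap_injective ℝ hne this)
  refine ⟨f ∘ φ, hf.comp (hφ.isClosedEmbedding hinj).isEmbedding, ?_, ?_,
    range_comp_subset_range φ f⟩
  · simp [φ]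
  · simp [φ]

theorem IsOpenSimplyConnected.isOpenConnected {A : Set Plane} (h : IsOpenSimplyConnected A) :
    IsOpenConnected A := ⟨h.1, h.2.isPathConnected.isConnected⟩

/-! ### Path-connected sets, open sets and polygonal loops. -/

theorem isConnected_thickening {E : Type*} [NormedAddCommGroup E] [NormedSpace ℝ E] {K : Set E}
    (hK : IsConnected K) {ε : ℝ} (hε : 0 < ε) : IsConnected (Metric.thickening ε K) := by
  rw [← add_ball_zero, ← image2_add, ← image_prod]
  exact (hK.prod (Metric.isConnected_ball hε)).image _ continuous_add.continuousOn

/-- Path-connected sets can be replaced by open connected sets. -/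
theorem isIntersectionGraph_isOpenConnected {V : Type*} [Finite V] {G : SimpleGraph V}
    (h : IsIntersectionGraph IsPathConnected G) : IsIntersectionGraph IsOpenConnected G := by
  classical
  obtain ⟨A, hA, hrep⟩ := h
  choose a ha using fun v => (hA v).nonempty
  have hp : ∀ u v, ∃ p, G.Adj u v → p ∈ A u ∩ A v := fun u v => by
    by_cases huv : G.Adj u v
    · obtain ⟨p, hp⟩ := (hrep u v huv.ne).1 huv
      exact ⟨p, fun _ => hp⟩
    · exact ⟨0, fun h => absurd h huv⟩
  choose p hp using hp
  -- The points `p u v` and `p v u` may differ, and the set of `u` must reach both; the flag tells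
  -- them apart. For non-neighbours the default is the base point.
  let q : V → V × Bool → Plane := fun u x =>
    if G.Adj u x.1 then (if x.2 then p u x.1 else p x.1 u) else a u
  have hq : ∀ u x, q u x ∈ A u := by
    intro u x
    simp only [q]
    split_ifs with h1 h2
    · exact (hp _ _ h1).1
    · exact (hp _ _ h1.symm).2
    · exact ha u
  let γ : ∀ u x, Path (a u) (q u x) := fun u x => ((hA u).joinedIn _ (ha u) _ (hq u x)).somePath
  -- A finite star of paths: its compactness gives disjoint ones disjoint thickenings.
  let K : V → Set Plane := fun u => ⋃ x, range (γ u x)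
  have hKA : ∀ u, K u ⊆ A u := fun u => iUnion_subset fun x => range_subset_iff.2 fun t =>
    ((hA u).joinedIn _ (ha u) _ (hq u x)).somePath_mem t
  have hKc : ∀ u, IsCompact (K u) := fun u =>
    isCompact_iUnion fun x => isCompact_range (γ u x).continuous
  have haK : ∀ u, a u ∈ K u := fun u => mem_iUnion.2 ⟨(u, true), 0, (γ u _).source⟩
  have hqK : ∀ u x, q u x ∈ K u := fun u x => mem_iUnion.2 ⟨x, 1, (γ u x).target⟩
  have hKconn : ∀ u, IsConnected (K u) := fun u => ⟨⟨_, haK u⟩, isPreconnected_iUnion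
    ⟨a u, mem_iInter.2 fun x => ⟨0, (γ u x).source⟩⟩
    fun x => isPreconnected_range (γ u x).continuous⟩
  have hsmall : ∀ᶠ ε : ℝ in 𝓝[>] 0, ∀ u v, u ≠ v → ¬G.Adj u v →
      Disjoint (Metric.thickening ε (K u)) (Metric.thickening ε (K v)) := by
    simp only [eventually_all]
    intro u v huv hadj
    have hd : Disjoint (K u) (K v) := by
      rw [disjoint_iff_inter_eq_empty, ← not_nonempty_iff_eq_empty]
      exact fun hne => hadj ((hrep u v huv).2 (hne.mono (inter_subset_inter (hKA u) (hKA v))))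
    obtain ⟨δ, hδ, hδd⟩ := hd.exists_thickenings (hKc u) (hKc v).isClosed
    filter_upwards [Ioo_mem_nhdsGT hδ] with ε hε
    exact hδd.mono (Metric.thickening_mono hε.2.le _) (Metric.thickening_mono hε.2.le _)
  obtain ⟨ε, hε, hε0⟩ := (hsmall.and self_mem_nhdsWithin).exists
  refine ⟨fun u => Metric.thickening ε (K u), fun u => ⟨Metric.isOpen_thickening,
    isConnected_thickening (hKconn u) hε0⟩, fun u v huv => ⟨fun hadj => ?_, fun hne => ?_⟩⟩
  · refine ⟨p u v, Metric.self_subset_thickening hε0 _ ?_,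
      Metric.self_subset_thickening hε0 _ ?_⟩
    · simpa [q, hadj] using hqK u (v, true)
    · simpa [q, hadj.symm] using hqK v (u, false)
  · by_contra hadj
    exact not_nonempty_iff_eq_empty.2 (disjoint_iff_inter_eq_empty.1 (hε u v huv hadj)) hne

/-- In the members of an open connected representation there are loops with the same
intersection pattern; adjacent loops cross each other stably. -/
theorem exists_stable_loops {V : Type*} [Finite V] {G : SimpleGraph V} {U : V → Set Plane}
    (hU : ∀ v, IsOpenConnected (U v)) (hrep : IsIntersectionRep G U) :
    ∃ (f : V → ℝ → Plane) (g : V → Plane → ℝ), (∀ v, IsPLLoop (f v)) ∧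
      (∀ v, f v '' Icc 0 1 ⊆ U v) ∧ (∀ v, Continuous (g v)) ∧
      (∀ v x, x ∈ f v '' Icc 0 1 ↔ g v x = 0) ∧ (∀ v, IsSimplyConnected {x | g v x < 0}) ∧
      (∀ v, {x | g v x < 0} ⊆ U v) ∧
      (∀ u v, G.Adj u v → (∃ x ∈ f u '' Icc 0 1, g v x < 0) ∧ ∃ x ∈ f u '' Icc 0 1, 0 < g v x) ∧
      ∀ u v, G.Adj u v → ({x | g u x < 0} ∩ {x | g v x < 0}).Nonempty := by
  classical
  -- One point for each ordered adjacent pair and each sign, all distinct.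
  let ι := {e : V × V × SignType // G.Adj e.1 e.2.1}
  have hS : ∀ e : ι, (U e.1.1 ∩ U e.1.2.1).Infinite := fun e => by
    obtain ⟨x, hx⟩ := (hrep _ _ e.2.ne).1 e.2
    exact infinite_of_mem_nhds x (((hU _).1.inter (hU _).1).mem_nhds hx)
  obtain ⟨P, hP, hPS⟩ := exists_injective_mem hS
  -- The point of sign 0 goes inside both loops; one of sign `s ≠ 0` goes on the first loop and on
  -- side `s` of the second.
  let κ : ∀ v, {e : ι // e.1.1 = v ∨ e.1.2.1 = v} → SignType := fun v e =>
    if e.1.1.2.2 = 0 then -1 else if e.1.1.1 = v then 0 else e.1.1.2.2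
  have hex := fun v => exists_isPLLoop_sign (hU v) (P := fun e : {e : ι // e.1.1 = v ∨ e.1.2.1 = v} =>
    P e.1) (hP.comp Subtype.val_injective) (fun e => by
      rcases e.2 with h | h
      · simpa only [h] using (hPS e.1).1
      · simpa only [h] using (hPS e.1).2) (κ v)
  choose f g hf hfU hg hfg hsign hsc hgU using hex
  refine ⟨f, g, hf, hfU, hg, hfg, hsc, hgU, fun u v huv => ?_, fun u v huv => ?_⟩
  · have key : ∀ s : SignType, s ≠ 0 → ∃ x ∈ f u '' Icc 0 1, SignType.sign (g v x) = s := by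
      intro s hs
      have h1 := hsign u ⟨⟨(u, v, s), huv⟩, .inl rfl⟩
      have h2 := hsign v ⟨⟨(u, v, s), huv⟩, .inr rfl⟩
      simp only [κ, hs, huv.ne, if_true, if_false] at h1 h2
      exact ⟨_, (hfg u _).2 (sign_eq_zero_iff.1 h1), h2⟩
    obtain ⟨x, hx, hxs⟩ := key (-1) (by decide)
    obtain ⟨y, hy, hys⟩ := key 1 (by decide)
    exact ⟨⟨x, hx, sign_eq_neg_one_iff.1 hxs⟩, ⟨y, hy, sign_eq_one_iff.1 hys⟩⟩
  · have h1 := hsign u ⟨⟨(u, v, 0), huv⟩, .inl rfl⟩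
    have h2 := hsign v ⟨⟨(u, v, 0), huv⟩, .inr rfl⟩
    simp only [κ, if_true] at h1 h2
    exact ⟨_, sign_eq_neg_one_iff.1 h1, sign_eq_neg_one_iff.1 h2⟩

/-- Open connected sets can be replaced by open simply connected sets. -/
theorem isIntersectionGraph_isOpenSimplyConnected {V : Type*} [Finite V] {G : SimpleGraph V}
    (h : IsIntersectionGraph IsOpenConnected G) :
    IsIntersectionGraph IsOpenSimplyConnected G := by
  obtain ⟨U, hU, hrep⟩ := h
  obtain ⟨f, g, -, -, hg, -, hsc, hgU, -, hadj⟩ := exists_stable_loops hU hrep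
  exact ⟨fun v => {x | g v x < 0}, fun v => ⟨isOpen_lt (hg v) continuous_const, hsc v⟩,
    fun u v huv => ⟨hadj u v, fun h => (hrep u v huv).2 (h.mono (inter_subset_inter (hgU u) (hgU v)))⟩⟩

/-- Open connected sets can be replaced by polygonal loops in general position, whose initial
vertices are not on the other loops. -/
theorem exists_loops_isInGeneralPosition {V : Type*} [Finite V] {G : SimpleGraph V}
    (h : IsIntersectionGraph IsOpenConnected G) :
    ∃ f : V → ℝ → Plane, (∀ v, IsPLLoop (f v)) ∧
      IsIntersectionRep G (fun v => f v '' Icc 0 1) ∧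
      IsInGeneralPosition (fun v => f v '' Icc 0 1) ∧
      ∀ u v, u ≠ v → f u 0 ∉ f v '' Icc 0 1 := by
  cases nonempty_fintype V
  obtain ⟨U, hU, hrep⟩ := h
  obtain ⟨f, g, hf, hfU, hg, hfg, -, -, hadj, -⟩ := exists_stable_loops hU hrep
  have h1 : ∀ᶠ w : V → Plane in 𝓝 0, ∀ v, ∀ s ∈ Icc (0 : ℝ) 1, f v s + w v ∈ U v := by
    rw [eventually_all]
    intro v
    obtain ⟨δ, hδ, hδU⟩ := (isCompact_Icc.image_of_continuousOn
      (hf v).continuousOn).exists_thickening_subset_open (hU v).1 (hfU v)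
    have hc : Continuous fun w : V → Plane => w v := continuous_apply v
    filter_upwards [hc.continuousAt.eventually (Metric.ball_mem_nhds _ hδ)] with w hw s hs
    refine hδU (Metric.mem_thickening_iff.2 ⟨f v s, ⟨s, hs, rfl⟩, ?_⟩)
    simpa [dist_eq_norm] using hw
  -- The value of `g v` at `x + w u - w v` tells the side of the translated loop `v` on which the
  -- translated point `x + w u` lies.
  have h2 : ∀ᶠ w : V → Plane in 𝓝 0, ∀ u v, G.Adj u v →
      (∃ x ∈ f u '' Icc 0 1, g v (x + w u - w v) < 0) ∧
      ∃ x ∈ f u '' Icc 0 1, 0 < g v (x + w u - w v) := by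
    simp only [eventually_all]
    intro u v huv
    obtain ⟨⟨x, hx, hx0⟩, y, hy, hy0⟩ := hadj u v huv
    have hc : ∀ z, ContinuousAt (fun w : V → Plane => g v (z + w u - w v)) 0 := fun z =>
      ((hg v).comp (by fun_prop)).continuousAt
    filter_upwards [(hc x).eventually_lt continuousAt_const (by simpa using hx0),
      continuousAt_const.eventually_lt (hc y) (by simpa using hy0)] with w hwx hwy
    exact ⟨⟨x, hx, hwx⟩, ⟨y, hy, hwy⟩⟩
  -- By Baire, generic translations are dense, so some are arbitrarily small.
  obtain ⟨w, ⟨hgp, hbase⟩, hw1, hw2⟩ :=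
    (dense_of_mem_residual (eventually_residual_isInGeneralPosition hf)).inter_nhds_nonempty
      (h1.and h2)
  refine ⟨fun v s => f v s + w v, fun v => (hf v).add_const _, fun u v huv =>
    ⟨fun ha => ?_, fun hne => ?_⟩, hgp, hbase⟩
  · obtain ⟨⟨x, hx, hx0⟩, y, hy, hy0⟩ := hw2 u v ha
    have hconn : IsPreconnected (f u '' Icc 0 1) :=
      isPreconnected_Icc.image _ (hf u).continuousOn
    have hc : Continuous fun z => g v (z + w u - w v) := (hg v).comp (by fun_prop)
    obtain ⟨z, ⟨s, hs, rfl⟩, hz0⟩ := hconn.intermediate_value hx hy hc.continuousOn ⟨hx0.le, hy0.le⟩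
    obtain ⟨r, hr, hrz⟩ := (hfg v _).2 hz0
    exact ⟨f u s + w u, ⟨s, hs, rfl⟩, ⟨r, hr, by simp [hrz]⟩⟩
  · obtain ⟨p, ⟨s, hs, rfl⟩, ⟨r, hr, hrs⟩⟩ := hne
    exact (hrep u v huv).2 ⟨_, hw1 u s hs, by simpa only [← hrs] using hw1 v r hr⟩

/-! ### From loops to simple curves. -/

theorem CrossProperlyAt.congr {A A' B B' : Set Plane} {p : Plane} (h : CrossProperlyAt A B p)
    (hA : ∀ᶠ q in 𝓝 p, q ∈ A' ↔ q ∈ A) (hB : ∀ᶠ q in 𝓝 p, q ∈ B' ↔ q ∈ B) :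
    CrossProperlyAt A' B' p := by
  obtain ⟨φ, hp, h0, hφ⟩ := h
  obtain ⟨W, hW, hWo, hpW⟩ := eventually_nhds_iff.1 (hA.and hB)
  refine ⟨φ.restrOpen W hWo, by simpa using ⟨hp, hpW⟩, h0, fun q hq => ?_⟩
  have hq' : q ∈ φ.source ∧ q ∈ W := by simpa using hq
  exact ⟨(hW q hq'.2).1.trans (hφ q hq'.1).1, (hW q hq'.2).2.trans (hφ q hq'.1).2⟩

/-- A loop can be cut open at its initial point, away from finitely many other points. -/
theorem IsPLLoop.exists_isSimpleCurve {f : ℝ → Plane} (hf : IsPLLoop f) {X : Set Plane}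
    (hX : X.Finite) (hXf : X ⊆ f '' Icc 0 1) (h0 : f 0 ∉ X) :
    ∃ A, IsSimpleCurve A ∧ A ⊆ f '' Icc 0 1 ∧ X ⊆ A ∧
      ∀ p ∈ X, ∀ᶠ q in 𝓝 p, q ∈ A ↔ q ∈ f '' Icc 0 1 := by
  have hX' : ∀ p ∈ X, ∃ s ∈ Ioo (0 : ℝ) 1, f s = p := by
    intro p hp
    obtain ⟨s, hs, rfl⟩ := hXf hp
    refine ⟨s, ⟨hs.1.lt_of_ne ?_, hs.2.lt_of_ne ?_⟩, rfl⟩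
    · rintro rfl; exact h0 hp
    · rintro rfl; exact h0 (hf.closed ▸ hp)
  have hev : ∀ᶠ δ : ℝ in 𝓝[>] 0, ∀ p ∈ X, ∃ s ∈ Ioo δ (1 - δ), f s = p := by
    rw [eventually_all_finite hX]
    intro p hp
    obtain ⟨s, hs, rfl⟩ := hX' p hp
    filter_upwards [Ioo_mem_nhdsGT hs.1, Ioo_mem_nhdsGT (sub_pos.2 hs.2)] with δ h1 h2
    exact ⟨s, ⟨h1.2, by linarith [h2.2]⟩, rfl⟩
  -- Deleting the parameters within `δ` of the two ends keeps all points of `X` in the interior of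
  -- the arc.
  obtain ⟨δ, hδX, hδ0, hδ1⟩ := (hev.and (Ioo_mem_nhdsGT (show (0 : ℝ) < 1 / 2 by norm_num))).exists
  have hsub : Icc δ (1 - δ) ⊆ Ico (0 : ℝ) 1 := fun s hs => ⟨by linarith [hs.1], by linarith [hs.2]⟩
  let φ : unitInterval → ℝ := fun c => lineMap δ (1 - δ) (c : ℝ)
  have hφm : ∀ c, φ c ∈ Icc δ (1 - δ) := fun c =>
    (convex_Icc δ (1 - δ)).lineMap_mem ⟨le_rfl, by linarith⟩ ⟨by linarith, le_rfl⟩ c.2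
  have hφc : Continuous φ := by
    simp only [φ, lineMap_apply_module]
    fun_prop
  have hφi : Function.Injective φ := fun a b hab =>
    Subtype.ext (lineMap_injective ℝ (show δ ≠ 1 - δ by linarith) hab)
  have hφr : range φ = Icc δ (1 - δ) := by
    refine Subset.antisymm (range_subset_iff.2 hφm) fun s hs => ?_
    have : 0 < 1 - δ - δ := by linarith
    refine ⟨⟨(s - δ) / (1 - δ - δ), div_nonneg (by linarith [hs.1]) this.le,
      (div_le_one this).2 (by linarith [hs.2])⟩, ?_⟩
    simp only [φ, lineMap_apply_module, smul_eq_mul]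
    field_simp
    ring
  have hc : Continuous (f ∘ φ) := (hf.continuousOn.comp_continuous hφc fun c =>
    Ico_subset_Icc_self (hsub (hφm c)))
  have hi : Function.Injective (f ∘ φ) := fun a b hab =>
    hφi (hf.injOn (hsub (hφm a)) (hsub (hφm b)) hab)
  refine ⟨f '' Icc δ (1 - δ), ⟨f ∘ φ, (hc.isClosedEmbedding hi).isEmbedding, ?_⟩,
    image_mono (hsub.trans Ico_subset_Icc_self), fun p hp => ?_, fun p hp => ?_⟩
  · rw [range_comp, hφr]
  · obtain ⟨s, hs, rfl⟩ := hδX p hp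
    exact ⟨s, Ioo_subset_Icc_self hs, rfl⟩
  · obtain ⟨s, hs, rfl⟩ := hδX p hp
    have hKsub : Icc 0 δ ∪ Icc (1 - δ) 1 ⊆ Icc (0 : ℝ) 1 :=
      union_subset (Icc_subset_Icc_right (by linarith)) (Icc_subset_Icc_left (by linarith))
    have hK : IsClosed (f '' (Icc 0 δ ∪ Icc (1 - δ) 1)) :=
      ((isCompact_Icc.union isCompact_Icc).image_of_continuousOn
        (hf.continuousOn.mono hKsub)).isClosed
    have hpK : f s ∉ f '' (Icc 0 δ ∪ Icc (1 - δ) 1) := by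
      rintro ⟨y, hy, hys⟩
      rcases (hKsub hy).2.eq_or_lt with rfl | hy1
      · exact h0 (by rwa [hf.closed, hys])
      · have := hf.injOn ⟨(hKsub hy).1, hy1⟩ (hsub (Ioo_subset_Icc_self hs)) hys
        subst this
        rcases hy with hy | hy
        · exact absurd hy.2 (not_le.2 hs.1)
        · exact absurd hy.1 (not_le.2 hs.2)
    filter_upwards [hK.isOpen_compl.mem_nhds hpK] with q hq
    refine ⟨fun h => image_mono (hsub.trans Ico_subset_Icc_self) h, ?_⟩
    rintro ⟨y, hy, rfl⟩
    refine ⟨y, ⟨?_, ?_⟩, rfl⟩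
    · by_contra! hlt
      exact hq ⟨y, .inl ⟨hy.1, hlt.le⟩, rfl⟩
    · by_contra! hlt
      exact hq ⟨y, .inr ⟨hlt.le, hy.2⟩, rfl⟩

theorem hasGeneralPositionRep_isPLSimpleClosedCurve {V : Type*} [Finite V] {G : SimpleGraph V}
    (h : IsIntersectionGraph IsOpenConnected G) :
    HasGeneralPositionRep IsPLSimpleClosedCurve G := by
  obtain ⟨f, hf, hrep, hgp, -⟩ := exists_loops_isInGeneralPosition h
  exact ⟨_, fun v => (hf v).isPLSimpleClosedCurve, hrep, hgp⟩

/-- Each loop is cut open keeping all its crossings; near these the arc agrees with the loop, so the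
crossings remain proper. -/
theorem hasGeneralPositionRep_isSimpleCurve {V : Type*} [Finite V] {G : SimpleGraph V}
    (h : IsIntersectionGraph IsOpenConnected G) : HasGeneralPositionRep IsSimpleCurve G := by
  obtain ⟨f, hf, hrep, hgp, hbase⟩ := exists_loops_isInGeneralPosition h
  have hex := fun v => (hf v).exists_isSimpleCurve
    (X := ⋃ u ∈ {u | u ≠ v}, f v '' Icc 0 1 ∩ f u '' Icc 0 1)
    ((toFinite _).biUnion fun u hu => hgp.finite_inter v u (Ne.symm hu))
    (iUnion₂_subset fun u _ => inter_subset_left) (by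
      simp only [mem_iUnion, not_exists]
      exact fun u hu h => hbase v u (Ne.symm hu) h.2)
  choose A hA hAf hXA hloc using hex
  have hX : ∀ u v, u ≠ v → ∀ p ∈ f u '' Icc 0 1 ∩ f v '' Icc 0 1,
      p ∈ ⋃ x ∈ {x | x ≠ u}, f u '' Icc 0 1 ∩ f x '' Icc 0 1 := fun u v huv p hp =>
    mem_biUnion (show v ∈ {x | x ≠ u} from huv.symm) hp
  have hsub : ∀ u v, A u ∩ A v ⊆ f u '' Icc 0 1 ∩ f v '' Icc 0 1 := fun u v =>
    inter_subset_inter (hAf u) (hAf v)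
  refine ⟨A, hA, fun u v huv => (hrep u v huv).trans
    ⟨fun ⟨p, hp⟩ => ⟨p, hXA u (hX u v huv p hp), hXA v (hX v u huv.symm p hp.symm)⟩,
      fun h => h.mono (hsub u v)⟩,
    fun u v huv => (hgp.finite_inter u v huv).subset (hsub u v), fun u v x huv hux hvx => ?_,
    fun u v huv p hp => ?_⟩
  · exact subset_empty_iff.1 ((inter_subset_inter (hsub u v) (hAf x)).trans
      (hgp.no_triple u v x huv hux hvx).subset)
  · have hp' := hsub u v hp
    exact (hgp.proper u v huv p hp').congr (hloc u p (hX u v huv p hp'))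
      (hloc v p (hX v u huv.symm p hp'.symm))

end StringGraphs

theorem lemmaA1 {V : Type*} [Finite V] (G : SimpleGraph V) :
    List.TFAE [
      StringGraphs.IsStringGraph G,
      StringGraphs.IsIntersectionGraph StringGraphs.IsSimpleCurve G,
      StringGraphs.IsIntersectionGraph StringGraphs.IsSimpleClosedCurve G,
      StringGraphs.IsIntersectionGraph StringGraphs.IsPLSimpleClosedCurve G,
      StringGraphs.IsIntersectionGraph IsPathConnected G,
      StringGraphs.IsIntersectionGraph StringGraphs.IsArcwiseConnected G,
      StringGraphs.IsIntersectionGraph StringGraphs.IsOpenConnected G,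
      StringGraphs.IsIntersectionGraph StringGraphs.IsOpenSimplyConnected G] ∧
    (StringGraphs.IsStringGraph G →
      StringGraphs.HasGeneralPositionRep StringGraphs.IsCurve G ∧
      StringGraphs.HasGeneralPositionRep StringGraphs.IsSimpleCurve G ∧
      StringGraphs.HasGeneralPositionRep StringGraphs.IsSimpleClosedCurve G ∧
      StringGraphs.HasGeneralPositionRep StringGraphs.IsPLSimpleClosedCurve G) := by
  open StringGraphs in
  have string_open (h : IsStringGraph G) : IsIntersectionGraph IsOpenConnected G :=
    isIntersectionGraph_isOpenConnected (h.mono fun _ => IsCurve.isPathConnected)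
  refine ⟨?_, fun h => ⟨(hasGeneralPositionRep_isSimpleCurve (string_open h)).mono
    fun _ => IsSimpleCurve.isCurve, hasGeneralPositionRep_isSimpleCurve (string_open h),
    (hasGeneralPositionRep_isPLSimpleClosedCurve (string_open h)).mono
      fun _ => IsPLSimpleClosedCurve.isSimpleClosedCurve,
    hasGeneralPositionRep_isPLSimpleClosedCurve (string_open h)⟩⟩
  -- Family 7 is the hub: 5 leads into it, and 2, 4 and 8 are constructed from it.
  tfae_have 1 → 7 := string_open
  tfae_have 7 → 4 := fun h => (hasGeneralPositionRep_isPLSimpleClosedCurve h).isIntersectionGraph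
  tfae_have 4 → 3 := .mono fun _ => IsPLSimpleClosedCurve.isSimpleClosedCurve
  tfae_have 3 → 5 := .mono fun _ => IsSimpleClosedCurve.isPathConnected
  tfae_have 5 → 7 := isIntersectionGraph_isOpenConnected
  tfae_have 7 → 2 := fun h => (hasGeneralPositionRep_isSimpleCurve h).isIntersectionGraph
  tfae_have 2 → 1 := .mono fun _ => IsSimpleCurve.isCurve
  tfae_have 2 → 6 := .mono fun _ => IsSimpleCurve.isArcwiseConnected
  tfae_have 6 → 5 := .mono fun _ => IsArcwiseConnected.isPathConnected
  tfae_have 7 → 8 := isIntersectionGraph_isOpenSimplyConnected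
  tfae_have 8 → 7 := .mono fun _ => IsOpenSimplyConnected.isOpenConnected
  tfae_finish
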